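/- Let $\beta>0$ and $h\in\mathbb{R}$. For $N\ge 1$ let $\mu_N$ be the Curie--Weiss Gibbs measure on $\{-1,+1\}^N$, $$\mu_N(\sigma)=\frac{1}{Z_N}\exp\Big(\frac{\beta}{2N}\sum_{i,j=1}^N\sigma_i\sigma_j+h\sum_{i=1}^N\sigma_i\Big),$$ where $Z_N$ is the normalizing constant, and for $k\le N$ let $\mathcal P_k(\sigma)=|\{1\le j\le k:\sigma_j=+1\}|$. Let $m=m(\beta,h)$ be the solution of $z=\tanh(\beta z+h)$ of largest absolute value, chosen nonnegative when $h=0$. Write $d_{TV}(\mu,\nu)=\sup_A|\mu(A)-\nu(A)|$ over Borel sets $A\subseteq\mathbb{R}$, let $\operatorname{Bin}(n,p)$ be the binomial distribution, and for $v_1,v_2>0$ let $$D(v_1,v_2)=\frac12\int_{\mathbb{R}}\left|\frac{e^{-t^2/(2v_1)}}{\sqrt{2\pi v_1}}-\frac{e^{-t^2/(2v_2)}}{\sqrt{2\pi v_2}}\right|\,dt$$ be the total variation distance between the centred Gaussian laws with variances $v_1$ and $v_2$. Let $k(N)$ be positive integers with $k(N)\le N$ for all large $N$, $k(N)\to\infty$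 and $k(N)/N\to\alpha\in[0,1]$ as $N\to\infty$. (i) If $h=0$ and $0<\beta<1$, then $$\lim_{N\to\infty}d_{TV}\big(\mu_N\circ\mathcal P_{k(N)}^{-1},\operatorname{Bin}(k(N),\tfrac12)\big)=D\Big(\frac{1-\beta+\alpha\beta}{4(1-\beta)},\frac14\Big).$$ (ii) If $h=0$ and $\beta>1$, then, with $m=m(\beta,0)$, $$\lim_{N\to\infty}d_{TV}\Big(\mu_N\circ\mathcal P_{k(N)}^{-1},\tfrac12\operatorname{Bin}\big(k(N),\tfrac{1+m}{2}\big)+\tfrac12\operatorname{Bin}\big(k(N),\tfrac{1-m}{2}\big)\Big)=D\Big(\frac{1-m^2}{4}\Big(1+\frac{\alpha\beta(1-m^2)}{1-\beta(1-m^2)}\Big),\frac{1-m^2}{4}\Big).$$ (iii) If $h\ne0$ and $\beta>0$, then, with $m=m(\beta,h)$, $$\lim_{N\to\infty}d_{TV}\big(\mu_N\circ\mathcal P_{k(N)}^{-1},\operatorname{Bin}\big(k(N),\tfrac{1+m}{2}\big)\big)=D\Big(\frac{1-m^2}{4}\Big(1+\frac{\alpha\beta(1-m^2)}{1-\beta(1-m^2)}\Big),\frac{1-m^2}{4}\Big).$$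 In each of the three cases the limit is zero if and only if $\alpha=0$. In particular, if $k(N)=o(N)$, then the total variation distances in (i), (ii) and (iii) converge to $0$. -/

import Mathlib

open Filter Topology MeasureTheory ProbabilityTheory Asymptotics
open scoped ENNReal

noncomputable section

namespace CurieWeiss

/-! ### The Gibbs measure; the spin space is `{-1, +1}^N`, with `{-1, +1}` realised as `ℤˣ` -/

/-- The unnormalised weight
`exp (β / (2N) * ∑ i j, σ i * σ j + h * ∑ i, σ i)` of a spin configuration. -/
def weight (β h : ℝ) {N : ℕ} (σ : Fin N → ℤˣ) : ℝ :=
  Real.exp (β / (2 * (N : ℝ)) * ∑ i, ∑ j, (((σ i : ℤ) : ℝ) * ((σ j : ℤ) : ℝ))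
    + h * ∑ i, ((σ i : ℤ) : ℝ))

/-- The partition function. -/
def partitionFunction (β h : ℝ) (N : ℕ) : ℝ := ∑ σ : Fin N → ℤˣ, weight β h σ

theorem weight_pos (β h : ℝ) {N : ℕ} (σ : Fin N → ℤˣ) : 0 < weight β h σ := Real.exp_pos _

theorem partitionFunction_pos (β h : ℝ) (N : ℕ) : 0 < partitionFunction β h N :=
  Finset.sum_pos (fun _ _ => Real.exp_pos _) Finset.univ_nonempty

theorem sum_weight_div (β h : ℝ) (N : ℕ) :
    ∑ σ : Fin N → ℤˣ, ENNReal.ofReal (weight β h σ / partitionFunction β h N) = 1 := by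
  rw [← ENNReal.ofReal_sum_of_nonneg
    (fun σ _ => div_nonneg (weight_pos β h σ).le (partitionFunction_pos β h N).le),
    ← Finset.sum_div]
  change ENNReal.ofReal (partitionFunction β h N / _) = 1
  rw [div_self (partitionFunction_pos β h N).ne', ENNReal.ofReal_one]

/-- The Curie-Weiss Gibbs measure on `{-1, +1}^N`. -/
def gibbs (β h : ℝ) (N : ℕ) : PMF (Fin N → ℤˣ) :=
  PMF.ofFintype (fun σ => ENNReal.ofReal (weight β h σ / partitionFunction β h N))
    (sum_weight_div β h N)

/-- The number of positive spins among the first `k` spins. -/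
def posSpins {N : ℕ} (k : ℕ) (σ : Fin N → ℤˣ) : ℕ :=
  (Finset.univ.filter fun j : Fin N => (j : ℕ) < k ∧ σ j = 1).card

/-- The law, as a measure on `ℝ`, of the number of positive spins among the first `k` spins
under the Gibbs measure. -/
def posSpinsLaw (β h : ℝ) (N k : ℕ) : Measure ℝ :=
  ((gibbs β h N).map fun σ => (posSpins k σ : ℝ)).toMeasure

/-! ### The magnetization parameter -/

/-- `m` is a solution of `z = tanh (β z + h)` of largest absolute value; when `h = 0`, the
solution set is symmetric and the nonnegative solution of largest absolute value is taken. -/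
structure IsMagnetization (β h m : ℝ) : Prop where
  eq_tanh : m = Real.tanh (β * m + h)
  abs_le : ∀ z : ℝ, z = Real.tanh (β * z + h) → |z| ≤ |m|
  nonneg : h = 0 → 0 ≤ m

theorem continuous_tanh : Continuous Real.tanh := by
  have : Real.tanh = fun x => Real.sinh x / Real.cosh x := by
    funext x; exact Real.tanh_eq_sinh_div_cosh x
  rw [this]
  exact Real.continuous_sinh.div Real.continuous_cosh fun x => (Real.cosh_pos x).ne'

theorem existsUnique_isMagnetization (β h : ℝ) : ∃! m, IsMagnetization β h m := by
  have hc : Continuous fun z : ℝ => Real.tanh (β * z + h) :=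
    continuous_tanh.comp (by fun_prop)
  have hS : IsCompact {z : ℝ | z = Real.tanh (β * z + h)} := by
    refine isCompact_Icc.of_isClosed_subset (isClosed_eq continuous_id hc)
      (?_ : _ ⊆ Set.Icc (-1 : ℝ) 1)
    intro z hz
    rw [Set.mem_ofPred_eq] at hz
    exact ⟨hz ▸ (Real.neg_one_lt_tanh _).le, hz ▸ (Real.tanh_lt_one _).le⟩
  have hne : {z : ℝ | z = Real.tanh (β * z + h)}.Nonempty := by
    have := intermediate_value_Icc (a := (-1 : ℝ)) (b := 1) (by norm_num)
      (f := fun z => z - Real.tanh (β * z + h)) (continuous_id.sub hc).continuousOn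
    obtain ⟨z, -, hz⟩ := this (show (0 : ℝ) ∈ _ from
      ⟨by have := Real.neg_one_lt_tanh (β * (-1) + h); linarith,
        by have := Real.tanh_lt_one (β * 1 + h); linarith⟩)
    exact ⟨z, sub_eq_zero.mp hz⟩
  obtain ⟨m, hm, hmax⟩ := hS.exists_isMaxOn hne continuous_abs.continuousOn
  have hmax' : ∀ z : ℝ, z = Real.tanh (β * z + h) → |z| ≤ |m| := fun z hz => hmax hz
  have hex : ∃ m, IsMagnetization β h m := by
    by_cases h0 : h = 0 ∧ m < 0
    · refine ⟨-m, ?_, ?_, fun _ => by linarith [h0.2]⟩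
      · have hm' : m = Real.tanh (β * m + h) := hm
        rw [h0.1] at hm' ⊢
        rw [add_zero] at *
        rw [mul_neg, Real.tanh_neg, ← hm']
      · simpa using hmax'
    · exact ⟨m, hm, hmax', fun hh => not_lt.mp fun hlt => h0 ⟨hh, hlt⟩⟩
  obtain ⟨a, ha⟩ := hex
  refine ⟨a, ha, fun b hb => ?_⟩
  rcases abs_eq_abs.mp (le_antisymm (ha.abs_le b hb.eq_tanh) (hb.abs_le a ha.eq_tanh)) with e | e
  · exact e
  · by_cases h0 : h = 0
    · have := ha.nonneg h0
      have := hb.nonneg h0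
      linarith
    · exfalso
      have h1 : Real.tanh (-(β * a + h)) = Real.tanh (β * b + h) := by
        rw [Real.tanh_neg, ← ha.eq_tanh, ← hb.eq_tanh, e]
      have h2 := Real.tanh_injective h1
      rw [e] at h2
      apply h0
      linarith

/-- The magnetization parameter `m(β, h)`. -/
def mag (β h : ℝ) : ℝ := (existsUnique_isMagnetization β h).choose

theorem mag_spec (β h : ℝ) : IsMagnetization β h (mag β h) :=
  (existsUnique_isMagnetization β h).choose_spec.1

theorem abs_mag_lt_one (β h : ℝ) : |mag β h| < 1 := by
  rw [(mag_spec β h).eq_tanh]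
  exact Real.abs_tanh_lt_one _

/-- The success probability `(1 + m(β, h)) / 2`. -/
def plusProb (β h : ℝ) : unitInterval :=
  ⟨(1 + mag β h) / 2, by have := abs_lt.mp (abs_mag_lt_one β h); constructor <;> linarith⟩

/-- The success probability `(1 - m(β, h)) / 2`. -/
def minusProb (β h : ℝ) : unitInterval :=
  ⟨(1 - mag β h) / 2, by have := abs_lt.mp (abs_mag_lt_one β h); constructor <;> linarith⟩

/-- The success probability `1 / 2`. -/
def halfProb : unitInterval := ⟨1 / 2, by constructor <;> norm_num⟩

/-! ### Binomial laws and their mixtures, as measures on `ℝ` -/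

/-- The binomial distribution with parameters `n` and `p`. -/
def binomialLaw (n : ℕ) (p : unitInterval) : Measure ℝ := (binomial n p).map (Nat.cast : ℕ → ℝ)

/-- The mixed binomial distribution `Bin (n, W)`, for a distribution `W` on `[0, 1]`: the mass of
`{j}` is the `W`-average over `p` of the mass that `Bin (n, p)` gives to `{j}`. -/
def mixedBinomialLaw (n : ℕ) (W : Measure unitInterval) : Measure ℝ :=
  ∑ j ∈ Finset.range (n + 1), (∫⁻ p, binomial n p {j} ∂W) • Measure.dirac (j : ℝ)

/-! ### Distances -/

/-- Total variation distance: the supremum of `|μ A - ν A|` over measurable sets `A`. -/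
def tvDist {Ω : Type*} [MeasurableSpace Ω] (μ ν : Measure Ω) : ℝ :=
  ⨆ A : {A : Set Ω // MeasurableSet A}, |μ.real A.1 - ν.real A.1|

/-- The total variation distance between the centred Gaussian distributions with (positive)
variances `v₁` and `v₂`, through their densities. -/
def gaussD (v₁ v₂ : ℝ) : ℝ :=
  1 / 2 * ∫ t : ℝ, |gaussianPDFReal 0 v₁.toNNReal t - gaussianPDFReal 0 v₂.toNNReal t|

end CurieWeiss

end

noncomputable section

namespace CurieWeiss

/-! ### Total variation distance of laws on `{0, …, n}` -/

/-! Linearising the energy (Hubbard–Stratonovich) writes the Gibbs weight as a Gaussian integral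
over an auxiliary variable `y`; given `y`, the spins are independent in the field `β y + h`. The
number of positive spins is therefore a mixture of binomials. The mixing variable concentrates at
`m` with fluctuations of order `1 / √N`, which move the binomial mean by order `k / √N`. On the
binomial scale `√k` this is of order `√(k / N)`, so it survives exactly when `α > 0`, and it adds `α
β w² / (4 (1 - β w))` to the binomial variance `w / 4`, where `w = 1 - m²`.

The argument is a local limit theorem. At `y = m` the integrand reproduces the binomial mass exactly
(`choose_mul_mixingWeight_div`), so the mass of `j` is a binomial mass times a ratio of two Laplace
integrals. The first factor is treated by Stirling's formula (`tendsto_sqrt_mul_binomialMass`), the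
second by dominated convergence after `y = m + s / √N` (`tendsto_integral_mul_mixingWeight`).
Domination needs a quadratic bound on the phase function: it comes from `cosh x ≤ exp (x² / 2)` when
`h = 0`, `β < 1`, and otherwise from the concavity of `log cosh` as a function of `x²`
(`log_cosh_lt_of_pos`). Pointwise convergence of densities becomes convergence in total variation by
Scheffé's lemma (`tendsto_half_sum_abs_sub`).

For `h = 0`, `β > 1` there are two maximisers `±m`. Both laws are symmetric about `k / 2`, so
folding them onto `2 j ≥ k` preserves their distance and leaves one Gaussian peak; the integral is
likewise folded onto `y > 0`.

The limit vanishes only when the two variances agree, since Gaussian densities of different variance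
already differ at the origin. -/

theorem tvDist_eq_half_sum {n : ℕ} {μ ν : Measure ℝ} {a b : ℕ → ℝ}
    (hμ : ∀ A : Set ℝ, MeasurableSet A →
      μ.real A = ∑ j ∈ Finset.range (n + 1), A.indicator 1 (j : ℝ) * a j)
    (hν : ∀ A : Set ℝ, MeasurableSet A →
      ν.real A = ∑ j ∈ Finset.range (n + 1), A.indicator 1 (j : ℝ) * b j)
    (hab : ∑ j ∈ Finset.range (n + 1), a j = ∑ j ∈ Finset.range (n + 1), b j) :
    tvDist μ ν = 1 / 2 * ∑ j ∈ Finset.range (n + 1), |a j - b j| := by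
  set R := Finset.range (n + 1)
  have hdiff : ∀ A : Set ℝ, MeasurableSet A →
      μ.real A - ν.real A = ∑ j ∈ R, A.indicator 1 (j : ℝ) * (a j - b j) := by
    intro A hA
    rw [hμ A hA, hν A hA, ← Finset.sum_sub_distrib]
    exact Finset.sum_congr rfl fun j _ => by ring
  have h0 : ∑ j ∈ R, (a j - b j) = 0 := by rw [Finset.sum_sub_distrib, hab, sub_self]
  have hbound : ∀ A : {A : Set ℝ // MeasurableSet A},
      |μ.real A.1 - ν.real A.1| ≤ 1 / 2 * ∑ j ∈ R, |a j - b j| := by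
    intro A
    -- Subtracting `1 / 2` from the indicator is free because the total masses agree; what remains
    -- has absolute value exactly `1 / 2`.
    have h1 : μ.real A.1 - ν.real A.1
        = ∑ j ∈ R, (A.1.indicator 1 (j : ℝ) - 1 / 2) * (a j - b j) := by
      rw [hdiff _ A.2]
      simp only [sub_mul, Finset.sum_sub_distrib, ← Finset.mul_sum, h0]
      ring
    rw [h1, Finset.mul_sum]
    refine (Finset.abs_sum_le_sum_abs _ _).trans (Finset.sum_le_sum fun j _ => ?_)
    rw [abs_mul]
    refine mul_le_mul_of_nonneg_right (le_of_eq ?_) (abs_nonneg _)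
    by_cases hj : (j : ℝ) ∈ A.1
    · rw [Set.indicator_of_mem hj, Pi.one_apply]; norm_num
    · rw [Set.indicator_of_notMem hj]; norm_num
  refine le_antisymm (ciSup_le hbound) ?_
  -- The supremum is attained on the event where the first mass function is at least the second.
  set S : Finset ℕ := R.filter fun j => 0 ≤ a j - b j
  set A : Set ℝ := (Nat.cast : ℕ → ℝ) '' (S : Set ℕ)
  have hA : MeasurableSet A := (S.finite_toSet.image _).measurableSet
  refine le_ciSup_of_le ⟨_, Set.forall_mem_range.2 hbound⟩ ⟨A, hA⟩ ?_
  refine le_trans (le_of_eq ?_) (le_abs_self _)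
  have h1 : μ.real A - ν.real A
        = ∑ j ∈ R, (A.indicator 1 (j : ℝ) - 1 / 2) * (a j - b j) := by
    rw [hdiff _ hA]
    simp only [sub_mul, Finset.sum_sub_distrib, ← Finset.mul_sum, h0]
    ring
  change _ = μ.real A - ν.real A
  rw [h1, Finset.mul_sum]
  refine Finset.sum_congr rfl fun j hj => ?_
  have hmem : (j : ℝ) ∈ A ↔ 0 ≤ a j - b j := by
    simp [A, S, hj]
  by_cases h : 0 ≤ a j - b j
  · rw [Set.indicator_of_mem (hmem.2 h), abs_of_nonneg h, Pi.one_apply]; ring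
  · rw [Set.indicator_of_notMem (fun h' => h (hmem.1 h')), abs_of_neg (not_le.1 h)]; ring

/-! ### Lattice laws as densities on the line -/

/-- The step function on `ℝ` carrying the mass function `a` on `ℕ`, after centring at `k p` and
rescaling by `√k`. -/
def latticeDensity (a : ℕ → ℝ) (k : ℕ) (p t : ℝ) : ℝ :=
  √k * if 0 ≤ ⌊k * p + t * √k⌋ then a ⌊k * p + t * √k⌋.toNat else 0

/-- Each lattice point owns a cell of width `1 / √k` on which the step function has height `√k * a
j`. This form makes integrability immediate and shows that the integral is the total mass. -/
theorem latticeDensity_eq_sum {a : ℕ → ℝ} {k : ℕ} (hk : 0 < k) (ha : ∀ j, k < j → a j = 0)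
    (p t : ℝ) :
    latticeDensity a k p t = ∑ j ∈ Finset.range (k + 1),
      (Set.Ico ((j - k * p) / √k) ((j + 1 - k * p) / √k)).indicator (fun _ => √k * a j) t := by
  have hs : 0 < √(k : ℝ) := Real.sqrt_pos.2 (by exact_mod_cast hk)
  have hmem : ∀ j : ℕ, t ∈ Set.Ico ((j - k * p) / √k) ((j + 1 - k * p) / √k) ↔
      ⌊k * p + t * √k⌋ = (j : ℤ) := by
    intro j
    rw [Int.floor_eq_iff, Set.mem_Ico, div_le_iff₀ hs, lt_div_iff₀ hs]
    push_cast
    constructor <;> rintro ⟨h1, h2⟩ <;> constructor <;> linarith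
  unfold latticeDensity
  simp only [Set.indicator_apply, hmem]
  split_ifs with h
  · obtain ⟨i, hi⟩ := Int.eq_ofNat_of_zero_le h
    rw [hi]
    simp only [Int.toNat_natCast, Nat.cast_inj, Finset.sum_ite_eq, Finset.mem_range]
    split_ifs with h'
    · rfl
    · rw [ha i (by omega), mul_zero]
  · rw [mul_zero]
    refine (Finset.sum_eq_zero fun j _ => if_neg ?_).symm
    omega

theorem integrable_latticeDensity {a : ℕ → ℝ} {k : ℕ} (hk : 0 < k) (ha : ∀ j, k < j → a j = 0)
    (p : ℝ) : Integrable (latticeDensity a k p) := by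
  have : latticeDensity a k p = fun t => ∑ j ∈ Finset.range (k + 1),
      (Set.Ico ((j - k * p) / √k) ((j + 1 - k * p) / √k)).indicator (fun _ => √k * a j) t :=
    funext fun t => latticeDensity_eq_sum hk ha p t
  rw [this]
  refine integrable_finsetSum _ fun j _ => ?_
  exact (integrable_indicator_iff measurableSet_Ico).2 (integrableOn_const (by simp))

theorem integral_latticeDensity {a : ℕ → ℝ} {k : ℕ} (hk : 0 < k) (ha : ∀ j, k < j → a j = 0)
    (p : ℝ) : ∫ t, latticeDensity a k p t = ∑ j ∈ Finset.range (k + 1), a j := by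
  have hs : 0 < √(k : ℝ) := Real.sqrt_pos.2 (by exact_mod_cast hk)
  simp only [latticeDensity_eq_sum hk ha]
  rw [integral_finsetSum]
  · refine Finset.sum_congr rfl fun j _ => ?_
    rw [integral_indicator measurableSet_Ico, setIntegral_const, measureReal_def, Real.volume_Ico,
      ENNReal.toReal_ofReal, smul_eq_mul]
    · field_simp; ring
    · rw [← sub_div]; apply div_nonneg _ hs.le; linarith
  · intro j _
    exact (integrable_indicator_iff measurableSet_Ico).2 (integrableOn_const (by simp))

theorem latticeDensity_nonneg {a : ℕ → ℝ} (ha : ∀ j, 0 ≤ a j) (k : ℕ) (p t : ℝ) :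
    0 ≤ latticeDensity a k p t := by
  unfold latticeDensity
  split_ifs
  · exact mul_nonneg (Real.sqrt_nonneg _) (ha _)
  · simp

theorem abs_latticeDensity_sub (a b : ℕ → ℝ) (k : ℕ) (p t : ℝ) :
    |latticeDensity a k p t - latticeDensity b k p t|
      = latticeDensity (fun j => |a j - b j|) k p t := by
  unfold latticeDensity
  split_ifs
  · rw [← mul_sub, abs_mul, abs_of_nonneg (Real.sqrt_nonneg _)]
  · simp

/-- Scheffé's lemma. -/
theorem tendsto_integral_abs_sub_of_tendsto {f : ℕ → ℝ → ℝ} {φ : ℝ → ℝ}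
    (hfi : ∀ᶠ n in atTop, Integrable (f n)) (hf0 : ∀ᶠ n in atTop, ∀ t, 0 ≤ f n t)
    (hf1 : ∀ᶠ n in atTop, ∫ t, f n t = 1)
    (hφi : Integrable φ) (hφ1 : ∫ t, φ t = 1)
    (hlim : ∀ t, Tendsto (fun n => f n t) atTop (𝓝 (φ t))) :
    Tendsto (fun n => ∫ t, |f n t - φ t|) atTop (𝓝 0) := by
  -- Since both integrals are `1`, the integral of `|f - φ|` is twice that of the positive part of
  -- `φ - f`, which is dominated by `φ` alone.
  have key : Tendsto (fun n => ∫ t, 2 * max (φ t - f n t) 0) atTop (𝓝 (∫ _ : ℝ, (0 : ℝ))) := by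
    refine tendsto_integral_filter_of_dominated_convergence (fun t => 2 * |φ t|) ?_ ?_ ?_ ?_
    · filter_upwards [hfi] with n hn
      exact (((hφi.sub hn).aestronglyMeasurable.sup aestronglyMeasurable_const)).const_mul 2
    · filter_upwards [hf0] with n hn
      refine ae_of_all _ fun t => ?_
      rw [Real.norm_eq_abs, abs_of_nonneg (by positivity)]
      have := hn t
      gcongr
      exact max_le (by linarith [le_abs_self (φ t)]) (abs_nonneg _)
    · exact hφi.abs.const_mul 2
    · refine ae_of_all _ fun t => ?_
      have := (((hlim t).const_sub (φ t)).max (tendsto_const_nhds (x := (0 : ℝ)))).const_mul 2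
      simpa using this
  rw [integral_zero] at key
  refine key.congr' ?_
  filter_upwards [hfi, hf1] with n hi h1
  have h2 : ∀ t, |f n t - φ t| = 2 * max (φ t - f n t) 0 - (φ t - f n t) := by
    intro t
    rcases le_total (φ t) (f n t) with h | h
    · rw [abs_of_nonneg (by linarith), max_eq_right (by linarith)]; ring
    · rw [abs_of_nonpos (by linarith), max_eq_left (by linarith)]; ring
  simp only [h2]
  have i₁ : Integrable fun t => 2 * max (φ t - f n t) 0 := (hφi.sub hi).pos_part.const_mul 2
  have i₂ : Integrable fun t => φ t - f n t := hφi.sub hi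
  rw [integral_sub i₁ i₂, integral_sub hφi hi, hφ1, h1]
  simp

/-- If two sequences of laws on `{0, …, k N}` satisfy Gaussian local limit theorems with the same
centring, then their total variation distances converge to that of the Gaussian limits. -/
theorem tendsto_half_sum_abs_sub {k : ℕ → ℕ} (hk : Tendsto k atTop atTop) {a b : ℕ → ℕ → ℝ}
    {p v₁ v₂ : ℝ} (hv₁ : 0 < v₁) (hv₂ : 0 < v₂)
    (ha0 : ∀ᶠ N in atTop, ∀ j, 0 ≤ a N j) (has : ∀ᶠ N in atTop, ∀ j, k N < j → a N j = 0)
    (ha1 : ∀ᶠ N in atTop, ∑ j ∈ Finset.range (k N + 1), a N j = 1)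
    (hb0 : ∀ᶠ N in atTop, ∀ j, 0 ≤ b N j) (hbs : ∀ᶠ N in atTop, ∀ j, k N < j → b N j = 0)
    (hb1 : ∀ᶠ N in atTop, ∑ j ∈ Finset.range (k N + 1), b N j = 1)
    (ha : ∀ t, Tendsto (fun N => latticeDensity (a N) (k N) p t) atTop
      (𝓝 (gaussianPDFReal 0 v₁.toNNReal t)))
    (hb : ∀ t, Tendsto (fun N => latticeDensity (b N) (k N) p t) atTop
      (𝓝 (gaussianPDFReal 0 v₂.toNNReal t))) :
    Tendsto (fun N => 1 / 2 * ∑ j ∈ Finset.range (k N + 1), |a N j - b N j|) atTop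
      (𝓝 (gaussD v₁ v₂)) := by
  have hk0 : ∀ᶠ N in atTop, 0 < k N := hk.eventually_gt_atTop 0
  have hscheffe : ∀ (c : ℕ → ℕ → ℝ) (v : ℝ), 0 < v → (∀ᶠ N in atTop, ∀ j, 0 ≤ c N j) →
      (∀ᶠ N in atTop, ∀ j, k N < j → c N j = 0) →
      (∀ᶠ N in atTop, ∑ j ∈ Finset.range (k N + 1), c N j = 1) →
      (∀ t, Tendsto (fun N => latticeDensity (c N) (k N) p t) atTop
        (𝓝 (gaussianPDFReal 0 v.toNNReal t))) →
      Tendsto (fun N => ∫ t, |latticeDensity (c N) (k N) p t - gaussianPDFReal 0 v.toNNReal t|)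
        atTop (𝓝 0) := by
    intro c v hv h0 hs h1 hc
    refine tendsto_integral_abs_sub_of_tendsto ?_ ?_ ?_ (integrable_gaussianPDFReal _ _)
      (integral_gaussianPDFReal_eq_one 0 (by simpa using hv)) hc
    · filter_upwards [hk0, hs] with N h2 h3 using integrable_latticeDensity h2 h3 p
    · filter_upwards [h0] with N h2 using latticeDensity_nonneg h2 _ _
    · filter_upwards [hk0, hs, h1] with N h2 h3 h4
      rw [integral_latticeDensity h2 h3, h4]
  have hA := hscheffe a v₁ hv₁ ha0 has ha1 ha
  have hB := hscheffe b v₂ hv₂ hb0 hbs hb1 hb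
  rw [tendsto_iff_dist_tendsto_zero]
  refine squeeze_zero' (Eventually.of_forall fun _ => dist_nonneg) ?_
    (by simpa using (hA.add hB).const_mul (1 / 2))
  filter_upwards [hk0, has, hbs] with N h0 h1 h2
  have hia := integrable_latticeDensity h0 h1 p
  have hib := integrable_latticeDensity h0 h2 p
  have hg₁ := integrable_gaussianPDFReal 0 v₁.toNNReal
  have hg₂ := integrable_gaussianPDFReal 0 v₂.toNNReal
  have i₁ : Integrable fun t => |latticeDensity (a N) (k N) p t - latticeDensity (b N) (k N) p t| :=
    (hia.sub hib).abs
  have i₂ : Integrable fun t =>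
      |gaussianPDFReal 0 v₁.toNNReal t - gaussianPDFReal 0 v₂.toNNReal t| := (hg₁.sub hg₂).abs
  have i₃ : Integrable fun t =>
      |latticeDensity (a N) (k N) p t - gaussianPDFReal 0 v₁.toNNReal t| := (hia.sub hg₁).abs
  have i₄ : Integrable fun t =>
      |latticeDensity (b N) (k N) p t - gaussianPDFReal 0 v₂.toNNReal t| := (hib.sub hg₂).abs
  have hsum : ∑ j ∈ Finset.range (k N + 1), |a N j - b N j|
      = ∫ t, |latticeDensity (a N) (k N) p t - latticeDensity (b N) (k N) p t| := by
    simp only [abs_latticeDensity_sub]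
    rw [integral_latticeDensity h0]
    intro j hj
    simp [h1 j hj, h2 j hj]
  rw [hsum, gaussD, Real.dist_eq, ← mul_sub, abs_mul, abs_of_nonneg (by norm_num : (0:ℝ) ≤ 1 / 2),
    ← integral_sub i₁ i₂, ← integral_add i₃ i₄]
  refine mul_le_mul_of_nonneg_left ?_ (by norm_num)
  refine (abs_integral_le_integral_abs).trans (integral_mono (i₁.sub i₂).abs (i₃.add i₄)
    fun t => ?_)
  refine (abs_abs_sub_abs_le_abs_sub _ _).trans ?_
  rw [sub_sub_sub_comm]
  exact abs_sub _ _

/-- A vanishing integral forces the continuous densities to agree everywhere; their values at `0`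
already determine the variances. -/
theorem gaussD_eq_zero_iff {v₁ v₂ : ℝ} (hv₁ : 0 < v₁) (hv₂ : 0 < v₂) :
    gaussD v₁ v₂ = 0 ↔ v₁ = v₂ := by
  refine ⟨fun h => ?_, fun h => by simp [gaussD, h]⟩
  have hcont : ∀ v : ℝ, Continuous (gaussianPDFReal 0 v.toNNReal) := fun v => by
    rw [gaussianPDFReal_def]; fun_prop
  have h1 : ∫ t : ℝ, |gaussianPDFReal 0 v₁.toNNReal t - gaussianPDFReal 0 v₂.toNNReal t| = 0 := by
    rw [gaussD] at h; linarith
  have h1' := (integral_eq_zero_iff_of_nonneg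
    (f := fun t => |gaussianPDFReal 0 v₁.toNNReal t - gaussianPDFReal 0 v₂.toNNReal t|)
    (fun _ => abs_nonneg _)
    ((integrable_gaussianPDFReal _ _).sub (integrable_gaussianPDFReal _ _)).abs).1 h1
  have h2 : |gaussianPDFReal 0 v₁.toNNReal 0 - gaussianPDFReal 0 v₂.toNNReal 0| = 0 :=
    congrFun (Continuous.ae_eq_iff_eq volume ((hcont v₁).sub (hcont v₂)).abs
    continuous_zero |>.1 h1') 0
  simp only [abs_eq_zero, sub_eq_zero] at h2
  simp only [gaussianPDFReal, Real.coe_toNNReal _ hv₁.le, Real.coe_toNNReal _ hv₂.le, sub_zero,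
    ne_eq, OfNat.ofNat_ne_zero, not_false_eq_true, zero_pow, neg_zero, zero_div, Real.exp_zero,
    mul_one, inv_inj] at h2
  have hpi := Real.pi_pos
  rw [Real.sqrt_inj (by positivity) (by positivity)] at h2
  exact mul_left_cancel₀ (by positivity) h2

/-! ### The local limit theorem for binomial laws -/

/-- Second-order Taylor expansion by l'Hôpital's rule. It is stated as an identity valid for every
`u`, including `0`, so that sequences tending to `0` can be substituted without asking whether they
vanish. -/
theorem exists_eq_sq_mul_of_hasDerivAt {f f' : ℝ → ℝ} {c : ℝ}
    (hf : ∀ᶠ u in 𝓝 0, HasDerivAt f (f' u) u) (h0 : f 0 = 0) (h0' : f' 0 = 0)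
    (hc : HasDerivAt f' c 0) :
    ∃ g : ℝ → ℝ, Tendsto g (𝓝 0) (𝓝 (c / 2)) ∧ ∀ u, f u = u ^ 2 * g u := by
  have hlim : Tendsto (fun u => f u / u ^ 2) (𝓝[≠] 0) (𝓝 (c / 2)) := by
    refine HasDerivAt.lhopital_zero_nhdsNE (f' := f') (g' := fun u => 2 * u)
      (hf.filter_mono nhdsWithin_le_nhds) ?_ ?_ ?_ ?_ ?_
    · exact Eventually.of_forall fun u => by simpa using hasDerivAt_pow 2 u
    · filter_upwards [self_mem_nhdsWithin] with u hu
      exact mul_ne_zero two_ne_zero hu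
    · have : Tendsto f (𝓝 0) (𝓝 (f 0)) := hf.self_of_nhds.continuousAt.tendsto
      rw [h0] at this
      exact this.mono_left nhdsWithin_le_nhds
    · have : Tendsto (fun u : ℝ => u ^ 2) (𝓝 0) (𝓝 (0 ^ 2)) := (continuous_pow 2).tendsto 0
      rw [zero_pow two_ne_zero] at this
      exact this.mono_left nhdsWithin_le_nhds
    · have := (hasDerivAt_iff_tendsto_slope.1 hc).div_const 2
      refine this.congr fun u => ?_
      rw [slope_def_field, h0', sub_zero, sub_zero, div_div, mul_comm]
  refine ⟨Function.update (fun u => f u / u ^ 2) 0 (c / 2), ?_, fun u => ?_⟩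
  · have : ContinuousAt (Function.update (fun u => f u / u ^ 2) 0 (c / 2)) 0 :=
      continuousAt_update_same.2 hlim
    simpa [ContinuousAt] using this
  · rcases eq_or_ne u 0 with rfl | hu
    · simp [h0]
    · rw [Function.update_of_ne hu]
      field_simp

/-- The mass that the binomial law with parameters `k` and `p` gives to `j`. -/
def binomialMass (k : ℕ) (p : ℝ) (j : ℕ) : ℝ := k.choose j * p ^ j * (1 - p) ^ (k - j)

theorem binomialMass_nonneg {p : ℝ} (hp0 : 0 ≤ p) (hp1 : p ≤ 1) (k j : ℕ) :
    0 ≤ binomialMass k p j := by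
  have : 0 ≤ 1 - p := by linarith
  unfold binomialMass
  positivity

theorem binomialMass_eq_zero {k j : ℕ} (h : k < j) (p : ℝ) : binomialMass k p j = 0 := by
  simp [binomialMass, Nat.choose_eq_zero_of_lt h]

theorem sum_binomialMass (k : ℕ) (p : ℝ) :
    ∑ j ∈ Finset.range (k + 1), binomialMass k p j = 1 := by
  have := add_pow p (1 - p) k
  rw [add_sub_cancel, one_pow] at this
  rw [this]
  exact Finset.sum_congr rfl fun j _ => by rw [binomialMass]; ring

/-- Stirling's formula in exact form: writing each factorial through `stirlingSeq` separates a
convergent prefactor from the exponential of a relative entropy. -/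
theorem sqrt_mul_binomialMass_eq {k j : ℕ} {p : ℝ} (hp0 : 0 < p) (hp1 : p < 1) (hj : 0 < j)
    (hjk : j < k) :
    √k * binomialMass k p j =
      Stirling.stirlingSeq k / (Stirling.stirlingSeq j * Stirling.stirlingSeq (k - j))
        * √(1 / (2 * ((j / k : ℝ) * (((k - j : ℕ) : ℝ) / k))))
        * Real.exp (-(j * Real.log (j / (k * p))
          + ((k - j : ℕ) : ℝ) * Real.log (((k - j : ℕ) : ℝ) / (k * (1 - p))))) := by
  obtain ⟨i, rfl⟩ := Nat.exists_eq_add_of_le hjk.le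
  have hi : 0 < i := by omega
  have hq : 0 < 1 - p := by linarith
  rw [Nat.add_sub_cancel_left]
  have hfac : ∀ n : ℕ, 0 < n → (n.factorial : ℝ)
      = Stirling.stirlingSeq n * (√(2 * n) * (n / Real.exp 1) ^ n) := by
    intro n hn
    have hn' : (0 : ℝ) < n := by exact_mod_cast hn
    rw [Stirling.stirlingSeq, div_mul_cancel₀]
    positivity
  have hS : ∀ n : ℕ, 0 < n → Stirling.stirlingSeq n ≠ 0 := by
    intro n hn
    have hn' : (0 : ℝ) < n := by exact_mod_cast hn
    rw [Stirling.stirlingSeq]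
    positivity
  have hj' : (0 : ℝ) < j := by exact_mod_cast hj
  have hi' : (0 : ℝ) < i := by exact_mod_cast hi
  have hk' : (0 : ℝ) < ((j + i : ℕ) : ℝ) := by exact_mod_cast (by omega : 0 < j + i)
  have hlog : ∀ (n : ℕ) (r : ℝ), 0 < n → 0 < r →
      Real.exp (-(n * Real.log (n / r))) = (r / n) ^ n := by
    intro n r hn hr
    have hn' : (0 : ℝ) < n := by exact_mod_cast hn
    rw [← mul_neg, ← Real.log_inv, inv_div, Real.exp_nat_mul, Real.exp_log (by positivity)]
  have hsq : √(1 / (2 * ((j / (j + i : ℕ) : ℝ) * ((i : ℝ) / (j + i : ℕ)))))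
      = √((j + i : ℕ) : ℝ) * √(2 * ((j + i : ℕ) : ℝ)) / (√(2 * j) * √(2 * i)) := by
    rw [← Real.sqrt_mul hk'.le, ← Real.sqrt_mul (by positivity), ← Real.sqrt_div (by positivity)]
    congr 1
    field_simp
  rw [neg_add, Real.exp_add, hlog j _ hj (by positivity), hlog i _ hi (by positivity), hsq,
    binomialMass, Nat.choose_symm_add, Nat.add_choose,
    Nat.cast_div (Nat.factorial_mul_factorial_dvd_factorial_add j i)
      (by positivity), Nat.cast_mul, hfac _ (by omega : 0 < j + i), hfac j hj, hfac i hi,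
    Nat.add_sub_cancel_left]
  have h1 := hS j hj
  have h2 := hS i hi
  simp only [div_pow, mul_pow, pow_add]
  field_simp

/-- De Moivre–Laplace along an arbitrary sequence of lattice points at the Gaussian scale. The
Stirling prefactors converge, and the entropy exponent is expanded to second order. -/
theorem tendsto_sqrt_mul_binomialMass {p t : ℝ} (hp0 : 0 < p) (hp1 : p < 1) {k j : ℕ → ℕ}
    (hk : Tendsto k atTop atTop)
    (hj : Tendsto (fun N => ((j N : ℝ) - k N * p) / √(k N)) atTop (𝓝 t)) :
    Tendsto (fun N => √(k N) * binomialMass (k N) p (j N)) atTop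
      (𝓝 (gaussianPDFReal 0 (p * (1 - p)).toNNReal t)) := by
  have hq : 0 < 1 - p := by linarith
  have hkR : Tendsto (fun N => (k N : ℝ)) atTop atTop := tendsto_natCast_atTop_atTop.comp hk
  have hsk : Tendsto (fun N => √(k N : ℝ)) atTop atTop := Real.tendsto_sqrt_atTop.comp hkR
  have hk0 : ∀ᶠ N in atTop, 0 < k N := hk.eventually_gt_atTop 0
  have hratio : Tendsto (fun N => (j N : ℝ) / k N) atTop (𝓝 p) := by
    have h1 : Tendsto (fun N => p + ((j N : ℝ) - k N * p) / √(k N) * (√(k N : ℝ))⁻¹) atTop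
        (𝓝 (p + t * 0)) := (hj.mul hsk.inv_tendsto_atTop).const_add p
    rw [mul_zero, add_zero] at h1
    refine h1.congr' ?_
    filter_upwards [hk0] with N hN
    have hN' : (0 : ℝ) < k N := by exact_mod_cast hN
    rw [← div_eq_mul_inv, div_div, Real.mul_self_sqrt hN'.le]
    field_simp
    ring
  have hj0 : ∀ᶠ N in atTop, 0 < j N := by
    filter_upwards [hk0, hratio.eventually (lt_mem_nhds hp0)] with N h1 h2
    by_contra h
    simp only [not_lt, Nat.le_zero] at h
    simp [h] at h2
  have hjk : ∀ᶠ N in atTop, j N < k N := by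
    filter_upwards [hk0, hratio.eventually (gt_mem_nhds hp1)] with N h1 h2
    have : (0 : ℝ) < k N := by exact_mod_cast h1
    rw [div_lt_one this] at h2
    exact_mod_cast h2
  have hjtop : Tendsto j atTop atTop := by
    rw [← tendsto_natCast_atTop_iff (R := ℝ)]
    refine (hkR.atTop_mul_pos hp0 hratio).congr' ?_
    filter_upwards [hk0] with N h1
    have : (0 : ℝ) < k N := by exact_mod_cast h1
    field_simp
  have hratio' : Tendsto (fun N => (((k N - j N : ℕ) : ℝ)) / k N) atTop (𝓝 (1 - p)) := by
    refine (hratio.const_sub 1).congr' ?_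
    filter_upwards [hk0, hjk] with N h1 h2
    have : (0 : ℝ) < k N := by exact_mod_cast h1
    rw [Nat.cast_sub h2.le]
    field_simp
  have hitop : Tendsto (fun N => k N - j N) atTop atTop := by
    rw [← tendsto_natCast_atTop_iff (R := ℝ)]
    refine (hkR.atTop_mul_pos hq hratio').congr' ?_
    filter_upwards [hk0] with N h1
    have : (0 : ℝ) < k N := by exact_mod_cast h1
    field_simp
  have hpi := Real.pi_pos
  have hspi : √Real.pi ≠ 0 := by positivity
  have hS := (Stirling.tendsto_stirlingSeq_sqrt_pi.comp hk).div
    ((Stirling.tendsto_stirlingSeq_sqrt_pi.comp hjtop).mul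
      (Stirling.tendsto_stirlingSeq_sqrt_pi.comp hitop)) (by positivity)
  have hR : Tendsto (fun N => √(1 / (2 * ((j N / k N : ℝ) * (((k N - j N : ℕ) : ℝ) / k N)))))
      atTop (𝓝 √(1 / (2 * (p * (1 - p))))) :=
    (Real.continuous_sqrt.tendsto _).comp
      (tendsto_const_nhds.div ((hratio.mul hratio').const_mul 2) (by positivity))
  -- The entropy terms are expanded at the relative deviations of `j` from `k p` and of `k - j` from
  -- `k (1 - p)`. The subtracted `u` costs nothing: weighted by `k p` and `k (1 - p)`, the two
  -- linear terms cancel.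
  obtain ⟨g, hg, hfg⟩ := exists_eq_sq_mul_of_hasDerivAt
    (f := fun u => (1 + u) * Real.log (1 + u) - u) (f' := fun u => Real.log (1 + u)) (c := 1)
    (by
      filter_upwards [lt_mem_nhds (show (-1 : ℝ) < 0 by norm_num)] with u hu
      have hu' : 1 + u ≠ 0 := by linarith
      have h1 : HasDerivAt (fun u : ℝ => 1 + u) 1 u := (hasDerivAt_id u).const_add 1
      convert! (h1.mul (h1.log hu')).sub (hasDerivAt_id u) using 1
      field_simp
      ring)
    (by simp) (by simp)
    (by
      have h1 : HasDerivAt (fun u : ℝ => 1 + u) 1 0 := (hasDerivAt_id 0).const_add 1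
      simpa using h1.log (by norm_num))
  have hE : Tendsto (fun N => -((j N : ℝ) * Real.log (j N / (k N * p))
      + ((k N - j N : ℕ) : ℝ) * Real.log (((k N - j N : ℕ) : ℝ) / (k N * (1 - p))))) atTop
      (𝓝 (-(t ^ 2 / p * (1 / 2) + t ^ 2 / (1 - p) * (1 / 2)))) := by
    have hu : Tendsto (fun N => (j N : ℝ) / k N / p - 1) atTop (𝓝 0) := by
      simpa [hp0.ne'] using (hratio.div_const p).sub_const 1
    have hw : Tendsto (fun N => ((k N - j N : ℕ) : ℝ) / k N / (1 - p) - 1) atTop (𝓝 0) := by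
      simpa [hq.ne'] using (hratio'.div_const (1 - p)).sub_const 1
    refine ((((hj.pow 2).div_const p).mul (hg.comp hu)).add
      (((hj.pow 2).div_const (1 - p)).mul (hg.comp hw))).neg.congr' ?_
    filter_upwards [hk0, hjk] with N h1 h2
    have hk' : (0 : ℝ) < k N := by exact_mod_cast h1
    have e1 := hfg ((j N : ℝ) / k N / p - 1)
    have e2 := hfg (((k N - j N : ℕ) : ℝ) / k N / (1 - p) - 1)
    rw [Nat.cast_sub h2.le] at e2 ⊢
    simp only [Function.comp_apply, add_sub_cancel, div_div, Nat.cast_sub h2.le] at e1 e2 ⊢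
    have a1 : (((j N : ℝ) - k N * p) / √(k N)) ^ 2 / p
        = k N * p * ((j N : ℝ) / (k N * p) - 1) ^ 2 := by
      rw [div_pow, Real.sq_sqrt hk'.le]
      field_simp
    have a2 : (((j N : ℝ) - k N * p) / √(k N)) ^ 2 / (1 - p)
        = k N * (1 - p) * (((k N : ℝ) - j N) / (k N * (1 - p)) - 1) ^ 2 := by
      rw [div_pow, Real.sq_sqrt hk'.le]
      field_simp
      ring
    rw [a1, a2, mul_assoc _ _ (g _), ← e1, mul_assoc _ _ (g _), ← e2]
    field_simp
    ring
  have hall := (hS.mul hR).mul ((Real.continuous_exp.tendsto _).comp hE)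
  have hval : √Real.pi / (√Real.pi * √Real.pi) * √(1 / (2 * (p * (1 - p))))
      * Real.exp (-(t ^ 2 / p * (1 / 2) + t ^ 2 / (1 - p) * (1 / 2)))
      = gaussianPDFReal 0 (p * (1 - p)).toNNReal t := by
    rw [gaussianPDFReal, Real.coe_toNNReal _ (by positivity), sub_zero]
    congr 1
    · rw [div_mul_cancel_left₀ hspi, ← Real.sqrt_inv, ← Real.sqrt_inv, ← Real.sqrt_mul (by positivity)]
      congr 1
      field_simp
    · congr 1
      field_simp
      ring
  rw [hval] at hall
  refine hall.congr' ?_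
  filter_upwards [hj0, hjk] with N h1 h2
  rw [sqrt_mul_binomialMass_eq hp0 hp1 h1 h2]
  rfl

/-- The lattice point whose cell contains `t` after centring at `k p` and rescaling by `√k`. -/
def cell (k : ℕ) (p t : ℝ) : ℕ := ⌊k * p + t * √k⌋.toNat

theorem eventually_floor_nonneg {k : ℕ → ℕ} (hk : Tendsto k atTop atTop) {p : ℝ} (hp : 0 < p)
    (t : ℝ) : ∀ᶠ N in atTop, 0 ≤ ⌊k N * p + t * √(k N)⌋ := by
  have hkR : Tendsto (fun N => (k N : ℝ)) atTop atTop := tendsto_natCast_atTop_atTop.comp hk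
  have hsk : Tendsto (fun N => √(k N : ℝ)) atTop atTop := Real.tendsto_sqrt_atTop.comp hkR
  filter_upwards [hsk.eventually_ge_atTop (|t| / p)] with N hN
  rw [Int.floor_nonneg]
  have h1 : |t| ≤ √(k N) * p := by rwa [div_le_iff₀ hp] at hN
  have h2 : (k N : ℝ) * p + t * √(k N) = √(k N) * (√(k N) * p + t) := by
    nth_rw 1 [← Real.mul_self_sqrt (Nat.cast_nonneg (k N))]
    ring
  rw [h2]
  exact mul_nonneg (Real.sqrt_nonneg _) (by linarith [neg_abs_le t])

theorem latticeDensity_eventuallyEq {k : ℕ → ℕ} (hk : Tendsto k atTop atTop) {p : ℝ} (hp : 0 < p)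
    (t : ℝ) (a : ℕ → ℕ → ℝ) :
    (fun N => latticeDensity (a N) (k N) p t) =ᶠ[atTop]
      fun N => √(k N) * a N (cell (k N) p t) := by
  filter_upwards [eventually_floor_nonneg hk hp t] with N hN
  rw [latticeDensity, if_pos hN, cell]

/-- Rounding down loses less than one lattice unit, that is, at most `1 / √k` after rescaling. -/
theorem tendsto_cell {k : ℕ → ℕ} (hk : Tendsto k atTop atTop) {p : ℝ} (hp : 0 < p) (t : ℝ) :
    Tendsto (fun N => ((cell (k N) p t : ℝ) - k N * p) / √(k N)) atTop (𝓝 t) := by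
  have hkR : Tendsto (fun N => (k N : ℝ)) atTop atTop := tendsto_natCast_atTop_atTop.comp hk
  have hsk : Tendsto (fun N => √(k N : ℝ)) atTop atTop := Real.tendsto_sqrt_atTop.comp hkR
  refine tendsto_of_tendsto_of_tendsto_of_le_of_le'
    (g := fun N => t - (√(k N : ℝ))⁻¹) (h := fun _ => t)
    (by simpa using hsk.inv_tendsto_atTop.const_sub t) tendsto_const_nhds ?_ ?_
  all_goals
    filter_upwards [eventually_floor_nonneg hk hp t, hk.eventually_gt_atTop 0] with N h1 h2
    have hs : 0 < √(k N : ℝ) := Real.sqrt_pos.2 (by exact_mod_cast h2)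
    have h3 : ((cell (k N) p t : ℕ) : ℝ) = (⌊k N * p + t * √(k N)⌋ : ℝ) := by
      rw [cell]
      exact_mod_cast congrArg (Int.cast : ℤ → ℝ) (Int.toNat_of_nonneg h1)
    rw [h3]
    have h4 := Int.floor_le (k N * p + t * √(k N))
    have h5 := Int.lt_floor_add_one (k N * p + t * √(k N))
  · rw [le_div_iff₀ hs, sub_mul, inv_mul_cancel₀ hs.ne']
    linarith
  · rw [div_le_iff₀ hs]
    linarith

/-! ### The law of the number of positive spins as a Gaussian mixture of binomial laws -/

theorem integrable_exp_quadratic {b : ℝ} (hb : 0 < b) (c : ℝ) :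
    Integrable fun y : ℝ => Real.exp (c * y - b * y ^ 2) := by
  have h := ((integrable_exp_neg_mul_sq hb).comp_sub_right (c / (2 * b))).const_mul
    (Real.exp (c ^ 2 / (4 * b)))
  refine h.congr (ae_of_all _ fun y => ?_)
  simp only
  rw [← Real.exp_add]
  congr 1
  field_simp
  ring

theorem integral_exp_quadratic {b : ℝ} (hb : 0 < b) (c : ℝ) :
    ∫ y : ℝ, Real.exp (c * y - b * y ^ 2) = √(Real.pi / b) * Real.exp (c ^ 2 / (4 * b)) := by
  have h : ∀ y : ℝ, Real.exp (c * y - b * y ^ 2)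
      = Real.exp (c ^ 2 / (4 * b)) * Real.exp (-b * (y - c / (2 * b)) ^ 2) := by
    intro y
    rw [← Real.exp_add]
    congr 1
    field_simp
    ring
  simp only [h]
  rw [integral_const_mul, integral_sub_right_eq_self (fun y => Real.exp (-b * y ^ 2)),
    integral_gaussian, mul_comm]

/-- The total spin of a configuration. -/
def totalSpin {N : ℕ} (σ : Fin N → ℤˣ) : ℝ := ∑ i, ((σ i : ℤ) : ℝ)

open Polynomial in
/-- The generating polynomial of the number of positive spins among the first `k`. -/
theorem sum_monomial_posSpins {N k : ℕ} (hkN : k ≤ N) (x : ℝ) :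
    ∑ σ : Fin N → ℤˣ, (C (Real.exp (x * totalSpin σ)) * X ^ posSpins k σ : ℝ[X])
      = (C (Real.exp x) * X + C (Real.exp (-x))) ^ k * C (2 * Real.cosh x) ^ (N - k) := by
  have h1 : ∀ σ : Fin N → ℤˣ, (C (Real.exp (x * totalSpin σ)) * X ^ posSpins k σ : ℝ[X])
      = ∏ i, C (Real.exp (x * ((σ i : ℤ) : ℝ))) * (if (i : ℕ) < k ∧ σ i = 1 then X else 1) := by
    intro σ
    rw [Finset.prod_mul_distrib, ← map_prod, ← Real.exp_sum, ← Finset.mul_sum, Finset.prod_ite,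
      Finset.prod_const, Finset.prod_const_one, mul_one]
    rfl
  -- With the energy linear in the spins, the sum over configurations factorises into a product over
  -- sites.
  have h2 := Finset.prod_univ_sum (fun _ : Fin N => (Finset.univ : Finset ℤˣ))
    (fun i ε => (C (Real.exp (x * ((ε : ℤ) : ℝ))) *
      (if (i : ℕ) < k ∧ ε = 1 then X else 1) : ℝ[X]))
  rw [Fintype.piFinset_univ] at h2
  simp only [h1]
  rw [← h2]
  have h3 : ∀ i : Fin N, ∑ ε : ℤˣ, (C (Real.exp (x * ((ε : ℤ) : ℝ))) *
      (if (i : ℕ) < k ∧ ε = 1 then X else 1) : ℝ[X])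
      = if (i : ℕ) < k then C (Real.exp x) * X + C (Real.exp (-x)) else C (2 * Real.cosh x) := by
    intro i
    have hne : (1 : ℤˣ) ≠ -1 := by decide
    rw [UnitsInt.univ, Finset.sum_pair hne]
    by_cases hi : (i : ℕ) < k
    · simp [hi, hne.symm]
    · simp only [hi, false_and, if_false, mul_one, ← C_add]
      congr 1
      rw [Real.cosh_eq]
      simp
      ring
  simp only [h3]
  rw [Finset.prod_ite, Finset.prod_const, Finset.prod_const, Fin.card_filter_val_lt,
    min_eq_right hkN]
  congr 2
  have := Finset.card_filter_add_card_filter_not (s := (Finset.univ : Finset (Fin N)))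
    (fun i => (i : ℕ) < k)
  rw [Fin.card_filter_val_lt, min_eq_right hkN, Finset.card_univ, Fintype.card_fin] at this
  omega

-- Reading off the coefficient of `X ^ j` in the generating polynomial.
open Polynomial in
theorem sum_exp_totalSpin_of_posSpins_eq {N k : ℕ} (hkN : k ≤ N) (x : ℝ) (j : ℕ) :
    ∑ σ : Fin N → ℤˣ, (if posSpins k σ = j then Real.exp (x * totalSpin σ) else 0)
      = k.choose j * (Real.exp (x * (2 * j - k)) * (2 * Real.cosh x) ^ (N - k)) := by
  have h := congrArg (fun P : ℝ[X] => P.coeff j) (sum_monomial_posSpins hkN x)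
  simp only [finsetSum_coeff, coeff_C_mul, coeff_X_pow, ← C_pow, coeff_mul_C] at h
  have h1 : ((C (Real.exp x) * X + C (Real.exp (-x))) ^ k).coeff j
      = k.choose j * Real.exp (x * (2 * j - k)) := by
    have h2 : ∀ m : ℕ, (C (Real.exp x) * X) ^ m * C (Real.exp (-x)) ^ (k - m) * (k.choose m : ℝ[X])
        = C (Real.exp x ^ m * Real.exp (-x) ^ (k - m) * k.choose m) * X ^ m := by
      intro m
      rw [mul_pow]
      simp only [map_mul, map_pow, map_natCast]
      ring
    rw [add_pow]
    simp only [h2, finsetSum_coeff, coeff_C_mul, coeff_X_pow, mul_ite, mul_one, mul_zero,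
      Finset.sum_ite_eq, Finset.mem_range]
    split_ifs with hj
    · rw [mul_comm, ← Real.exp_nat_mul, ← Real.exp_nat_mul, ← Real.exp_add,
        Nat.cast_sub (by omega)]
      congr 2
      ring
    · rw [Nat.choose_eq_zero_of_lt (by omega), Nat.cast_zero, zero_mul]
  rw [h1, mul_assoc] at h
  rw [← h]
  refine Finset.sum_congr rfl fun σ _ => ?_
  simp [eq_comm]

/-- The Hubbard–Stratonovich identity: the double sum is the square of the total spin, and
completing the square in `y` turns the exponential of a square into a Gaussian average of
exponentials linear in the spins. -/
theorem weight_eq_integral {β : ℝ} (hβ : 0 < β) (h : ℝ) {N : ℕ} (hN : 0 < N) (σ : Fin N → ℤˣ) :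
    weight β h σ = √(N * β / (2 * Real.pi)) *
      ∫ y : ℝ, Real.exp ((β * y + h) * totalSpin σ) * Real.exp (-(N * β / 2 * y ^ 2)) := by
  have hN' : (0 : ℝ) < N := by exact_mod_cast hN
  have hpi := Real.pi_pos
  have h1 : ∀ y : ℝ, Real.exp ((β * y + h) * totalSpin σ) * Real.exp (-(N * β / 2 * y ^ 2))
      = Real.exp (h * totalSpin σ) *
        Real.exp (β * totalSpin σ * y - N * β / 2 * y ^ 2) := by
    intro y
    rw [← Real.exp_add, ← Real.exp_add]
    congr 1
    ring
  simp only [h1]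
  rw [integral_const_mul, integral_exp_quadratic (by positivity)]
  have h2 : √(N * β / (2 * Real.pi)) * √(Real.pi / (N * β / 2)) = 1 := by
    rw [← Real.sqrt_mul (by positivity), Real.sqrt_eq_one]
    field_simp
  have h3 : ∑ i, ∑ j, (((σ i : ℤ) : ℝ) * ((σ j : ℤ) : ℝ)) = totalSpin σ ^ 2 := by
    rw [totalSpin, sq, Finset.sum_mul_sum]
  rw [weight, h3, mul_left_comm, ← mul_assoc √_ √_, h2, one_mul, ← Real.exp_add]
  congr 1
  rw [totalSpin]
  field_simp
  ring

/-- The integrand of the Gaussian mixture: the joint weight of the mixing variable `y` and of a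
prescribed configuration of `k` spins, `j` of them positive, the other spins being summed out. -/
def mixingWeight (β h : ℝ) (N k j : ℕ) (y : ℝ) : ℝ :=
  Real.exp ((β * y + h) * (2 * j - k)) * (2 * Real.cosh (β * y + h)) ^ (N - k)
    * Real.exp (-(N * β / 2 * y ^ 2))

/-- The probability under the Gibbs measure that `j` of the first `k` spins are positive. -/
def posSpinsMass (β h : ℝ) (N k j : ℕ) : ℝ :=
  k.choose j * ((∫ y, mixingWeight β h N k j y) / ∫ y, mixingWeight β h N 0 0 y)

theorem sum_weight_of_posSpins_eq {β : ℝ} (hβ : 0 < β) (h : ℝ) {N k : ℕ} (hN : 0 < N)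
    (hkN : k ≤ N) (j : ℕ) :
    ∑ σ : Fin N → ℤˣ, (if posSpins k σ = j then weight β h σ else 0)
      = √(N * β / (2 * Real.pi)) * (k.choose j * ∫ y, mixingWeight β h N k j y) := by
  have hN' : (0 : ℝ) < N := by exact_mod_cast hN
  have h1 : ∀ y, (k.choose j : ℝ) * mixingWeight β h N k j y
      = ∑ σ : Fin N → ℤˣ, (if posSpins k σ = j then
          Real.exp ((β * y + h) * totalSpin σ) * Real.exp (-(N * β / 2 * y ^ 2)) else 0) := by
    intro y
    rw [mixingWeight, ← mul_assoc, ← sum_exp_totalSpin_of_posSpins_eq hkN, Finset.sum_mul]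
    exact Finset.sum_congr rfl fun σ _ => by rw [ite_mul, zero_mul]
  rw [← integral_const_mul]
  simp only [h1]
  rw [integral_finsetSum, Finset.mul_sum]
  · refine Finset.sum_congr rfl fun σ _ => ?_
    split_ifs
    · exact weight_eq_integral hβ h hN σ
    · simp
  · intro σ _
    split_ifs
    · refine ((integrable_exp_quadratic (b := N * β / 2) (by positivity)
        (β * totalSpin σ)).const_mul (Real.exp (h * totalSpin σ))).congr (ae_of_all _ fun y => ?_)
      simp only
      rw [← Real.exp_add, ← Real.exp_add]
      congr 1
      ring
    · exact integrable_zero _ _ _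

theorem partitionFunction_eq_integral {β : ℝ} (hβ : 0 < β) (h : ℝ) {N : ℕ} (hN : 0 < N) :
    partitionFunction β h N = √(N * β / (2 * Real.pi)) * ∫ y, mixingWeight β h N 0 0 y := by
  have := sum_weight_of_posSpins_eq hβ h hN (Nat.zero_le N) 0
  simpa [posSpins, partitionFunction] using this

theorem posSpins_le {N : ℕ} (k : ℕ) (σ : Fin N → ℤˣ) : posSpins k σ ≤ k := by
  calc posSpins k σ ≤ (Finset.univ.filter fun j : Fin N => (j : ℕ) < k).card :=
        Finset.card_le_card (Finset.monotone_filter_right _ fun _ _ h => h.1)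
    _ ≤ k := by rw [Fin.card_filter_val_lt]; exact min_le_right _ _

theorem posSpinsMass_eq_sum {β : ℝ} (hβ : 0 < β) (h : ℝ) {N k : ℕ} (hN : 0 < N)
    (hkN : k ≤ N) (j : ℕ) :
    posSpinsMass β h N k j
      = (∑ σ : Fin N → ℤˣ, (if posSpins k σ = j then weight β h σ else 0))
        / partitionFunction β h N := by
  have hN' : (0 : ℝ) < N := by exact_mod_cast hN
  have hpi := Real.pi_pos
  have hc : √(N * β / (2 * Real.pi)) ≠ 0 := by positivity
  rw [sum_weight_of_posSpins_eq hβ h hN hkN, partitionFunction_eq_integral hβ h hN,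
    mul_div_mul_left _ _ hc, posSpinsMass, mul_div_assoc]

theorem posSpinsMass_nonneg {β : ℝ} (hβ : 0 < β) (h : ℝ) {N k : ℕ} (hN : 0 < N)
    (hkN : k ≤ N) (j : ℕ) : 0 ≤ posSpinsMass β h N k j := by
  rw [posSpinsMass_eq_sum hβ h hN hkN]
  refine div_nonneg (Finset.sum_nonneg fun σ _ => ?_) (partitionFunction_pos β h N).le
  split_ifs
  exacts [(weight_pos β h σ).le, le_rfl]

theorem posSpinsMass_eq_zero (β h : ℝ) (N : ℕ) {k j : ℕ} (hj : k < j) :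
    posSpinsMass β h N k j = 0 := by
  rw [posSpinsMass, Nat.choose_eq_zero_of_lt hj, Nat.cast_zero, zero_mul]

/-- Change of variables for the law of the number of positive spins; `f = 1` gives the total mass,
an indicator gives the measure of a set. -/
theorem sum_posSpinsMass_mul {β : ℝ} (hβ : 0 < β) (h : ℝ) {N k : ℕ} (hN : 0 < N)
    (hkN : k ≤ N) (f : ℕ → ℝ) :
    ∑ j ∈ Finset.range (k + 1), f j * posSpinsMass β h N k j
      = ∑ σ : Fin N → ℤˣ, f (posSpins k σ) * (weight β h σ / partitionFunction β h N) := by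
  simp only [posSpinsMass_eq_sum hβ h hN hkN, Finset.sum_div, Finset.mul_sum]
  rw [Finset.sum_comm]
  refine Finset.sum_congr rfl fun σ _ => ?_
  rw [Finset.sum_eq_single (posSpins k σ)]
  · rw [if_pos rfl]
  · intro j _ hj
    rw [if_neg hj.symm, zero_div, mul_zero]
  · intro hj
    exact absurd (Finset.mem_range.2 (Nat.lt_succ_of_le (posSpins_le k σ))) hj

theorem sum_posSpinsMass {β : ℝ} (hβ : 0 < β) (h : ℝ) {N k : ℕ} (hN : 0 < N) (hkN : k ≤ N) :
    ∑ j ∈ Finset.range (k + 1), posSpinsMass β h N k j = 1 := by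
  have := sum_posSpinsMass_mul hβ h hN hkN fun _ => 1
  simp only [one_mul] at this
  rw [this, ← Finset.sum_div]
  exact div_self (partitionFunction_pos β h N).ne'

theorem posSpinsLaw_real {β : ℝ} (hβ : 0 < β) (h : ℝ) {N k : ℕ} (hN : 0 < N) (hkN : k ≤ N)
    {A : Set ℝ} (hA : MeasurableSet A) :
    (posSpinsLaw β h N k).real A
      = ∑ j ∈ Finset.range (k + 1), A.indicator 1 (j : ℝ) * posSpinsMass β h N k j := by
  rw [sum_posSpinsMass_mul hβ h hN hkN (fun j => A.indicator 1 (j : ℝ)), measureReal_def,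
    posSpinsLaw, PMF.toMeasure_apply_eq_toOuterMeasure_apply _ hA, PMF.toOuterMeasure_map_apply,
    PMF.toOuterMeasure_apply_fintype, ENNReal.toReal_sum]
  · refine Finset.sum_congr rfl fun σ _ => ?_
    have hw : 0 ≤ weight β h σ / partitionFunction β h N :=
      div_nonneg (weight_pos β h σ).le (partitionFunction_pos β h N).le
    by_cases hσ : (posSpins k σ : ℝ) ∈ A
    · rw [Set.indicator_of_mem (by exact hσ), Set.indicator_of_mem hσ, Pi.one_apply, one_mul, gibbs,
        PMF.ofFintype_apply, ENNReal.toReal_ofReal hw]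
    · rw [Set.indicator_of_notMem (by exact hσ), Set.indicator_of_notMem hσ, zero_mul,
        ENNReal.toReal_zero]
  · intro σ _
    by_cases hσ : (posSpins k σ : ℝ) ∈ A
    · rw [Set.indicator_of_mem (by exact hσ)]
      exact PMF.apply_ne_top _ _
    · rw [Set.indicator_of_notMem (by exact hσ)]
      exact ENNReal.zero_ne_top

/-! ### The function `log cosh` -/

theorem hasDerivAt_log_cosh (x : ℝ) :
    HasDerivAt (fun x => Real.log (Real.cosh x)) (Real.tanh x) x := by
  rw [Real.tanh_eq_sinh_div_cosh]
  exact (Real.hasDerivAt_cosh x).log (Real.cosh_pos x).ne'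

theorem hasDerivAt_tanh (x : ℝ) : HasDerivAt Real.tanh (1 - Real.tanh x ^ 2) x := by
  have h : Real.tanh = fun x => Real.sinh x / Real.cosh x :=
    funext fun x => Real.tanh_eq_sinh_div_cosh x
  have hc := (Real.cosh_pos x).ne'
  rw [h]
  convert! (Real.hasDerivAt_sinh x).div (Real.hasDerivAt_cosh x) hc using 1
  field_simp

theorem strictMono_tanh : StrictMono Real.tanh := by
  refine strictMono_of_deriv_pos fun x => ?_
  rw [(hasDerivAt_tanh x).deriv, sub_pos, sq_lt_one_iff_abs_lt_one]
  exact Real.abs_tanh_lt_one x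

theorem log_cosh_le_abs (x : ℝ) : Real.log (Real.cosh x) ≤ |x| := by
  rw [← Real.cosh_abs, Real.log_le_iff_le_exp (Real.cosh_pos _), Real.cosh_eq]
  have : Real.exp (-|x|) ≤ Real.exp |x| := Real.exp_le_exp.2 (by linarith [abs_nonneg x])
  linarith

/-- After multiplication by `cosh² x` this is `x < sinh x * cosh x`. It makes `tanh x / x`
decreasing, and at `x = β m` it gives `β (1 - m²) < 1`. -/
theorem mul_one_sub_tanh_sq_lt {x : ℝ} (hx : 0 < x) :
    x * (1 - Real.tanh x ^ 2) < Real.tanh x := by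
  have hc := Real.cosh_pos x
  have h1 : x < Real.sinh x := Real.self_lt_sinh_iff.2 hx
  have h2 : 1 ≤ Real.cosh x := Real.one_le_cosh x
  have h3 : 1 - Real.tanh x ^ 2 = 1 / Real.cosh x ^ 2 := by
    rw [Real.tanh_eq_sinh_div_cosh]
    have := Real.cosh_sq x
    field_simp
    linarith
  rw [h3, Real.tanh_eq_sinh_div_cosh, mul_one_div, div_lt_div_iff₀ (by positivity) hc]
  nlinarith [mul_pos hx hc, mul_pos (hx.trans h1) hc]

theorem strictAntiOn_tanh_div : StrictAntiOn (fun x => Real.tanh x / x) (Set.Ioi 0) := by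
  have hd : ∀ x ∈ Set.Ioi (0 : ℝ), HasDerivAt (fun x => Real.tanh x / x)
      (((1 - Real.tanh x ^ 2) * x - Real.tanh x * 1) / x ^ 2) x := fun x hx =>
    (hasDerivAt_tanh x).div (hasDerivAt_id x) (ne_of_gt hx)
  refine strictAntiOn_of_deriv_neg (convex_Ioi 0)
    (fun x hx => (hd x hx).continuousAt.continuousWithinAt) fun x hx => ?_
  rw [interior_Ioi] at hx
  rw [(hd x hx).deriv]
  refine div_neg_of_neg_of_pos ?_ (pow_pos hx 2)
  linarith [mul_one_sub_tanh_sq_lt hx]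

/-- As a function of `x²`, `log cosh x` has derivative `tanh x / (2 x)`, which decreases; it is
therefore strictly concave and lies below its tangent line in the variable `x²`. -/
theorem log_cosh_lt_of_pos {x₀ x : ℝ} (hx₀ : 0 < x₀) (hx : 0 ≤ x) (hne : x ≠ x₀) :
    Real.log (Real.cosh x) <
      Real.log (Real.cosh x₀) + Real.tanh x₀ / (2 * x₀) * (x ^ 2 - x₀ ^ 2) := by
  set F : ℝ → ℝ := fun x => Real.tanh x₀ / (2 * x₀) * x ^ 2 - Real.log (Real.cosh x)
  have hd : ∀ x, HasDerivAt F (Real.tanh x₀ / x₀ * x - Real.tanh x) x := fun x => by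
    convert! ((hasDerivAt_pow 2 x).const_mul (Real.tanh x₀ / (2 * x₀))).sub
      (hasDerivAt_log_cosh x) using 1
    field_simp
    push_cast
    ring
  have hc : Continuous F := continuous_iff_continuousAt.2 fun x => (hd x).continuousAt
  suffices F x₀ < F x by simp only [F] at this; rw [mul_sub]; linarith
  rcases lt_or_gt_of_ne hne with h | h
  · refine (strictAntiOn_of_deriv_neg (convex_Icc 0 x₀) hc.continuousOn fun y hy => ?_)
      ⟨hx, h.le⟩ ⟨hx₀.le, le_rfl⟩ h
    rw [interior_Icc] at hy
    rw [(hd y).deriv]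
    have := strictAntiOn_tanh_div (Set.mem_Ioi.2 hy.1) (Set.mem_Ioi.2 hx₀) hy.2
    rw [lt_div_iff₀ hy.1] at this
    linarith
  · refine (strictMonoOn_of_deriv_pos (convex_Ici x₀) hc.continuousOn fun y hy => ?_)
      (Set.self_mem_Ici) h.le h
    rw [interior_Ici] at hy
    rw [(hd y).deriv]
    have hy0 : 0 < y := hx₀.trans hy
    have := strictAntiOn_tanh_div (Set.mem_Ioi.2 hx₀) (Set.mem_Ioi.2 hy0) hy
    rw [div_lt_iff₀ hy0] at this
    linarith

theorem log_cosh_le_of_ne_zero {x₀ : ℝ} (hx₀ : x₀ ≠ 0) (x : ℝ) :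
    Real.log (Real.cosh x) ≤
      Real.log (Real.cosh x₀) + Real.tanh x₀ / (2 * x₀) * (x ^ 2 - x₀ ^ 2) := by
  have h1 : Real.tanh x₀ / (2 * x₀) = Real.tanh |x₀| / (2 * |x₀|) := by
    rcases abs_choice x₀ with h | h
    · rw [h]
    · rw [h, Real.tanh_neg, mul_neg, neg_div_neg_eq]
  rw [h1, ← sq_abs x, ← sq_abs x₀, ← Real.cosh_abs x, ← Real.cosh_abs x₀]
  rcases eq_or_ne |x| |x₀| with h | h
  · rw [h]; simp
  · exact (log_cosh_lt_of_pos (abs_pos.2 hx₀) (abs_nonneg x) h).le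

/-- The excess of `log cosh` over its tangent at `x₀`. -/
def tangentExcess (x₀ u : ℝ) : ℝ :=
  Real.log (Real.cosh (x₀ + u)) - Real.log (Real.cosh x₀) - Real.tanh x₀ * u

theorem hasDerivAt_tangentExcess (x₀ u : ℝ) :
    HasDerivAt (tangentExcess x₀) (Real.tanh (x₀ + u) - Real.tanh x₀) u := by
  have h := (hasDerivAt_log_cosh (x₀ + u)).comp_const_add x₀ u
  convert! (h.sub_const (Real.log (Real.cosh x₀))).sub
    ((hasDerivAt_id u).const_mul (Real.tanh x₀)) using 1
  simp

theorem continuous_tangentExcess (x₀ : ℝ) : Continuous (tangentExcess x₀) :=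
  continuous_iff_continuousAt.2 fun u => (hasDerivAt_tangentExcess x₀ u).continuousAt

/-- Convexity of `log cosh`. Here it follows from `exp (a u) ≤ cosh u + a sinh u` for `|a| ≤ 1`,
with `a = tanh x₀`. -/
theorem tangentExcess_nonneg (x₀ u : ℝ) : 0 ≤ tangentExcess x₀ u := by
  have hc := Real.cosh_pos x₀
  have h := Real.exp_mul_le_cosh_add_mul_sinh (Real.abs_tanh_lt_one x₀).le u
  have h1 : Real.cosh (x₀ + u)
      = Real.cosh x₀ * (Real.cosh u + Real.tanh x₀ * Real.sinh u) := by
    rw [Real.cosh_add, Real.tanh_eq_sinh_div_cosh]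
    field_simp
  have h2 := (Real.exp_pos _).trans_le h
  rw [tangentExcess, h1, Real.log_mul hc.ne' h2.ne']
  have h3 := (Real.le_log_iff_exp_le h2).2 h
  linarith

theorem exists_tangentExcess_eq (x₀ : ℝ) : ∃ g : ℝ → ℝ,
    Tendsto g (𝓝 0) (𝓝 ((1 - Real.tanh x₀ ^ 2) / 2)) ∧
      ∀ u, tangentExcess x₀ u = u ^ 2 * g u := by
  refine exists_eq_sq_mul_of_hasDerivAt
    (Eventually.of_forall fun u => hasDerivAt_tangentExcess x₀ u)
    (by simp [tangentExcess]) (by simp) ?_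
  have := ((hasDerivAt_tanh (x₀ + 0)).comp_const_add x₀ 0).sub_const (Real.tanh x₀)
  simpa using this

/-- The phase function `z ↦ β z² / 2 - tangentExcess x₀ (β z)` dominates `c z²` on `E`. -/
def HasQuadraticGap (β x₀ c : ℝ) (E : Set ℝ) : Prop :=
  ∀ z ∈ E, tangentExcess x₀ (β * z) ≤ (β / 2 - c) * z ^ 2

theorem hasQuadraticGap_of_lt_one {β : ℝ} :
    HasQuadraticGap β 0 (β * (1 - β) / 2) Set.univ := by
  intro z _
  have h := (Real.log_le_iff_le_exp (Real.cosh_pos _)).2 (Real.cosh_le_exp_half_sq (β * z))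
  rw [tangentExcess]
  simp only [zero_add, Real.cosh_zero, Real.log_one, Real.tanh_zero]
  linarith

/-- With `x₀ = β m + h` and `m = tanh x₀`, the tangent bound in `x²` becomes a pure quadratic in `z`
with coefficient `β² m / (2 x₀) = (β / 2) (1 - h / x₀)`. The gap is useful when `h` and `x₀` have
the same sign. -/
theorem hasQuadraticGap_of_ne_zero {β h m : ℝ} (hx₀ : β * m + h ≠ 0)
    (hm : m = Real.tanh (β * m + h)) :
    HasQuadraticGap β (β * m + h) (β * h / (2 * (β * m + h))) Set.univ := by
  intro z _
  have hle := log_cosh_le_of_ne_zero hx₀ (β * m + h + β * z)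
  rw [tangentExcess]
  rw [← hm] at hle ⊢
  have e : m / (2 * (β * m + h)) * ((β * m + h + β * z) ^ 2 - (β * m + h) ^ 2) - m * (β * z)
      = (β / 2 - β * h / (2 * (β * m + h))) * z ^ 2 := by
    obtain ⟨x₀, hx⟩ : ∃ x₀, x₀ = β * m + h := ⟨_, rfl⟩
    have hh : h = x₀ - β * m := by linarith
    rw [← hx] at hx₀ ⊢
    rw [hh]
    field_simp
    ring
  linarith

/-- No positive gap holds on the whole line, because the opposite maximiser sits at `z = -2 m`; the
half-line `z ≥ -m` excludes it. There the normalised phase is continuous and positive, hence bounded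
below on a compact interval, and beyond it the linear growth of `log cosh` suffices. -/
theorem exists_hasQuadraticGap_of_pos {β m : ℝ} (hβ : 0 < β) (hm0 : 0 < m)
    (hm : m = Real.tanh (β * m)) :
    ∃ c, 0 < c ∧ HasQuadraticGap β (β * m) c (Set.Ici (-m)) := by
  obtain ⟨g, hg, hgeq⟩ := exists_tangentExcess_eq (β * m)
  rw [← hm] at hg
  have hx₀ : 0 < β * m := by positivity
  have hgcont : Continuous g := by
    refine continuous_iff_continuousAt.2 fun u => ?_
    rcases eq_or_ne u 0 with rfl | hu
    · exact continuousAt_of_tendsto_nhds hg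
    · have : ContinuousAt (fun u => tangentExcess (β * m) u / u ^ 2) u :=
        (continuous_tangentExcess _).continuousAt.div (continuousAt_id.pow 2) (pow_ne_zero 2 hu)
      refine this.congr ?_
      filter_upwards [isOpen_ne.mem_nhds hu] with v hv
      rw [hgeq]
      have hv' : v ≠ 0 := hv
      field_simp
  have hg0 : g 0 = (1 - m ^ 2) / 2 :=
    tendsto_nhds_unique (hgcont.tendsto 0) hg
  set r : ℝ → ℝ := fun z => β / 2 - β ^ 2 * g (β * z)
  have hr : ∀ z, tangentExcess (β * m) (β * z) = (β / 2 - r z) * z ^ 2 := fun z => by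
    rw [hgeq]; simp only [r]; ring
  have hrcont : Continuous r := by fun_prop
  have hrpos : ∀ z, -m ≤ z → 0 < r z := by
    intro z hz
    rcases eq_or_ne z 0 with rfl | hz0
    · simp only [r, mul_zero, hg0]
      have := mul_one_sub_tanh_sq_lt hx₀
      rw [← hm] at this
      have h1 : β * (1 - m ^ 2) < 1 := by
        rw [mul_right_comm, mul_comm] at this
        exact (mul_lt_iff_lt_one_right hm0).1 this
      have h2 := mul_lt_mul_of_pos_left h1 hβ
      linarith
    · have hlt := log_cosh_lt_of_pos hx₀ (x := β * m + β * z)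
        (by rw [← mul_add]; exact mul_nonneg hβ.le (by linarith))
        (by simp [hβ.ne', hz0])
      have h1 := hr z
      rw [tangentExcess] at h1
      rw [← hm] at hlt h1
      have e : m / (2 * (β * m)) * ((β * m + β * z) ^ 2 - (β * m) ^ 2) - m * (β * z)
          = β / 2 * z ^ 2 := by
        field_simp
        ring
      have hz2 : 0 < z ^ 2 := by positivity
      have : 0 < r z * z ^ 2 := by linarith
      exact pos_of_mul_pos_left this hz2.le
  -- Large enough that `m + z ≤ z² / 4` for `z ≥ M`.
  set M := 4 * (m + 1)
  obtain ⟨z₁, hz₁, hmin⟩ := isCompact_Icc.exists_isMinOn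
    (Set.nonempty_Icc.2 (by simp only [M]; linarith : -m ≤ M)) hrcont.continuousOn
  refine ⟨min (r z₁) (β / 4), lt_min (hrpos z₁ hz₁.1) (by positivity), fun z hz => ?_⟩
  rcases le_total z M with hzM | hzM
  · rw [hr]
    have h1 : r z₁ ≤ r z := hmin ⟨hz, hzM⟩
    have h2 : min (r z₁) (β / 4) ≤ r z₁ := min_le_left _ _
    refine mul_le_mul_of_nonneg_right (by linarith) (sq_nonneg z)
  · have hz1 : 0 < z := by simp only [M] at hzM; linarith
    have h1 := log_cosh_le_abs (β * m + β * z)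
    rw [abs_of_pos (by positivity)] at h1
    have h2 : 0 ≤ Real.log (Real.cosh (β * m)) := Real.log_nonneg (Real.one_le_cosh _)
    have h3 : β * (m + z) ≤ β * (z ^ 2 / 4) := by
      refine mul_le_mul_of_nonneg_left ?_ hβ.le
      simp only [M] at hzM
      nlinarith
    have h4 : 0 ≤ m * (β * z) := by positivity
    have h5 : (β / 2 - β / 4) * z ^ 2 ≤ (β / 2 - min (r z₁) (β / 4)) * z ^ 2 :=
      mul_le_mul_of_nonneg_right (by linarith [min_le_right (r z₁) (β / 4)]) (sq_nonneg z)
    rw [tangentExcess, ← hm]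
    linarith

/-- Letting `z → 0` compares second derivatives. For `c > 0` and `m = tanh x₀` this yields `β (1 -
m²) < 1`, the nondegeneracy of the maximiser. -/
theorem HasQuadraticGap.mul_lt_one {β x₀ c : ℝ} {E : Set ℝ} (hgap : HasQuadraticGap β x₀ c E)
    (hE : E ∈ 𝓝 0) :
    β ^ 2 * (1 - Real.tanh x₀ ^ 2) ≤ β - 2 * c := by
  obtain ⟨g, hg, hgeq⟩ := exists_tangentExcess_eq x₀
  have h1 : Tendsto (fun z => β ^ 2 * g (β * z)) (𝓝[≠] 0)
      (𝓝 (β ^ 2 * ((1 - Real.tanh x₀ ^ 2) / 2))) := by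
    refine (hg.comp ?_).const_mul _
    have : Tendsto (fun z : ℝ => β * z) (𝓝 0) (𝓝 (β * 0)) :=
      tendsto_id.const_mul β
    rw [mul_zero] at this
    exact this.mono_left nhdsWithin_le_nhds
  have h2 : β ^ 2 * ((1 - Real.tanh x₀ ^ 2) / 2) ≤ β / 2 - c := by
    refine le_of_tendsto h1 ?_
    filter_upwards [nhdsWithin_le_nhds hE, self_mem_nhdsWithin] with z hz hz0
    have h3 := hgap z hz
    rw [hgeq, mul_pow] at h3
    have hz2 : 0 < z ^ 2 := by have : z ≠ 0 := hz0; positivity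
    refine le_of_mul_le_mul_right ?_ hz2
    linarith
  linarith

/-! ### The magnetization -/

/-- The graph of `tanh` starts above the diagonal at `y` and is below it at `1`, so it crosses in
between. -/
theorem exists_gt_eq_tanh {β h y : ℝ} (hy : y < Real.tanh (β * y + h)) :
    ∃ z, y < z ∧ z = Real.tanh (β * z + h) := by
  have hy1 : y ≤ 1 := (hy.trans (Real.tanh_lt_one _)).le
  have hc : Continuous fun z => z - Real.tanh (β * z + h) :=
    continuous_id.sub (continuous_tanh.comp (by fun_prop))
  obtain ⟨z, hz, hz0⟩ := intermediate_value_Icc hy1 hc.continuousOn (show (0 : ℝ) ∈ _ from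
    ⟨by linarith, by linarith [Real.tanh_lt_one (β * 1 + h)]⟩)
  have hz0' : z = Real.tanh (β * z + h) := sub_eq_zero.1 hz0
  refine ⟨z, lt_of_le_of_ne hz.1 ?_, hz0'⟩
  rintro rfl
  exact hy.ne hz0'

theorem IsMagnetization.neg {β h m : ℝ} (hm : IsMagnetization β h m) (hh : h ≠ 0) :
    IsMagnetization β (-h) (-m) where
  eq_tanh := by
    rw [mul_neg, ← neg_add, Real.tanh_neg, ← hm.eq_tanh]
  abs_le z hz := by
    have := hm.abs_le (-z) (by
      rw [mul_neg, ← sub_eq_neg_add, ← neg_sub, Real.tanh_neg, ← sub_eq_add_neg] at *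
      rw [← hz])
    simpa using this
  nonneg h0 := absurd (neg_eq_zero.1 h0) hh

/-- If `β m + h ≤ 0` then `m ≤ 0`, and for `h > 0` the point `-m` lies strictly below the `tanh`
curve. A solution beyond `-m` then exists, contradicting the maximality of `|m|`. -/
theorem IsMagnetization.pos_of_pos {β h m : ℝ} (hm : IsMagnetization β h m)
    (hh : 0 < h) : 0 < β * m + h := by
  by_contra hx
  rw [not_lt] at hx
  have hm0 : m ≤ 0 := by
    rw [hm.eq_tanh, ← Real.tanh_zero]
    exact strictMono_tanh.monotone hx
  have h1 : -m < Real.tanh (β * -m + h) := by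
    have h2 : -m = Real.tanh (β * -m + -h) := by
      rw [mul_neg, ← neg_add, Real.tanh_neg, ← hm.eq_tanh]
    nth_rw 1 [h2]
    exact strictMono_tanh (by linarith)
  obtain ⟨z, hz, hzeq⟩ := exists_gt_eq_tanh h1
  have h3 := hm.abs_le z hzeq
  rw [abs_of_nonpos hm0, abs_of_pos (by linarith)] at h3
  linarith

theorem IsMagnetization.div_pos {β h m : ℝ} (hm : IsMagnetization β h m) (hh : h ≠ 0) :
    0 < h / (β * m + h) := by
  rcases lt_or_gt_of_ne hh with h0 | h0
  · have := (hm.neg hh).pos_of_pos (neg_pos.2 h0)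
    exact div_pos_of_neg_of_neg h0 (by linarith)
  · exact _root_.div_pos h0 (hm.pos_of_pos h0)

/-- At the origin `tanh (β z)` has slope `β > 1`, so it exceeds `z` just to the right of `0`, and a
positive solution exists; `0` is then not of largest absolute value. -/
theorem IsMagnetization.pos_of_one_lt {β m : ℝ} (hm : IsMagnetization β 0 m) (hβ : 1 < β) :
    0 < m := by
  refine lt_of_le_of_ne (hm.nonneg rfl) ?_
  rintro rfl
  have hd : HasDerivAt (fun z => Real.tanh (β * z) - z) (β - 1) 0 := by
    have h1 := (hasDerivAt_tanh (β * 0)).comp 0 ((hasDerivAt_id (0 : ℝ)).const_mul β)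
    convert! h1.sub (hasDerivAt_id (0 : ℝ)) using 1
    simp
  have h2 := (hasDerivAt_iff_tendsto_slope.1 hd).eventually (lt_mem_nhds (sub_pos.2 hβ))
  have h3 : ∀ᶠ z in 𝓝[>] (0 : ℝ), z < Real.tanh (β * z + 0) := by
    filter_upwards [h2.filter_mono (nhdsWithin_mono _ fun z (hz : 0 < z) => hz.ne'),
      self_mem_nhdsWithin] with z hz hz0
    rw [slope_def_field] at hz
    simp only [mul_zero, Real.tanh_zero, sub_zero] at hz
    have hz0' : 0 < z := hz0
    rw [add_zero]
    have := (div_pos_iff_of_pos_right hz0').1 hz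
    linarith
  obtain ⟨y, hy, hy0⟩ := (h3.and self_mem_nhdsWithin).exists
  obtain ⟨z, hz, hzeq⟩ := exists_gt_eq_tanh hy
  have h4 := hm.abs_le z hzeq
  have hy0' : 0 < y := hy0
  rw [abs_zero, abs_of_pos (hy0'.trans hz)] at h4
  linarith

/-! ### Laplace asymptotics of the mixing integrals -/

theorem measurable_mixingWeight (β h : ℝ) (N k j : ℕ) : Measurable (mixingWeight β h N k j) := by
  have h1 : Measurable fun y : ℝ => Real.cosh (β * y + h) :=
    Real.measurable_cosh.comp (by fun_prop)
  unfold mixingWeight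
  fun_prop

theorem mixingWeight_pos (β h : ℝ) (N k j : ℕ) (y : ℝ) : 0 < mixingWeight β h N k j y := by
  have := Real.cosh_pos (β * y + h)
  unfold mixingWeight
  positivity

/-- Because `m = tanh (β m + h)`, the first-order terms of the `N - k` summed-out spins and of the
Gaussian combine into the centred deviation `2 j - k - k m`. -/
theorem mixingWeight_add {β h m : ℝ} (hm : m = Real.tanh (β * m + h)) {N k : ℕ} (hkN : k ≤ N)
    (j : ℕ) (z : ℝ) :
    mixingWeight β h N k j (m + z) = mixingWeight β h N k j m *
      Real.exp (β * z * (2 * j - k - k * m) + (N - k) * tangentExcess (β * m + h) (β * z)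
        - N * β / 2 * z ^ 2) := by
  have hcosh : ∀ x : ℝ, (2 * Real.cosh x) ^ (N - k)
      = Real.exp ((N - k) * (Real.log 2 + Real.log (Real.cosh x))) := by
    intro x
    have hx := Real.cosh_pos x
    rw [← Real.log_mul two_ne_zero hx.ne', ← Nat.cast_sub hkN, Real.exp_nat_mul,
      Real.exp_log (by positivity)]
  rw [mixingWeight, mixingWeight, hcosh, hcosh, tangentExcess, ← hm]
  simp only [← Real.exp_add]
  congr 1
  rw [show β * (m + z) + h = β * m + h + β * z by ring]
  ring

/-- The exponent of `mixingWeight_add` at `z = s / √N`. -/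
theorem rescaled_exponent_eq {β x₀ m : ℝ} {N k j : ℕ} (hN : 0 < N) (s : ℝ) :
    β * (s / √N) * (2 * j - k - k * m) + (N - k) * tangentExcess x₀ (β * (s / √N))
        - N * β / 2 * (s / √N) ^ 2
      = β * s * ((2 * j - k - k * m) / √N) + (N - k) * tangentExcess x₀ (β * (s / √N))
        - β / 2 * s ^ 2 := by
  have hN' : (0 : ℝ) < N := by exact_mod_cast hN
  rw [div_pow, Real.sq_sqrt hN'.le]
  field_simp

theorem integral_comp_add_div_sqrt (N : ℕ) (F : ℝ → ℝ) (m : ℝ) :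
    ∫ s, F (m + s / √N) = √N * ∫ y, F y := by
  rw [Measure.integral_comp_div (fun z => F (m + z)), abs_of_nonneg (Real.sqrt_nonneg _),
    smul_eq_mul, integral_add_left_eq_self F m]

/-- Laplace's method at scale `1 / √N`. The factor `w` vanishes where the quadratic gap is
unavailable, so one statement serves both the whole line and the half-line of the two-phase case. -/
theorem tendsto_integral_mul_mixingWeight {β h m α δ c C W : ℝ} {E : Set ℝ} {k j : ℕ → ℕ}
    {w : ℕ → ℝ → ℝ} (hβ : 0 < β) (hm : m = Real.tanh (β * m + h))
    (hc : 0 < c) (hgap : HasQuadraticGap β (β * m + h) c E)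
    (hkN : ∀ᶠ N in atTop, k N ≤ N)
    (hkα : Tendsto (fun N : ℕ => (k N : ℝ) / N) atTop (𝓝 α))
    (hδ : Tendsto (fun N : ℕ => (2 * j N - k N - k N * m : ℝ) / √N) atTop (𝓝 δ))
    (hwm : ∀ N, Measurable (w N)) (hwC : ∀ᶠ N in atTop, ∀ y, |w N y| ≤ C)
    (hwE : ∀ N y, y - m ∉ E → w N y = 0)
    (hw : ∀ s, Tendsto (fun N : ℕ => w N (m + s / √N)) atTop (𝓝 W)) :
    Tendsto (fun N : ℕ => √N * ((∫ y, w N y * mixingWeight β h N (k N) (j N) y)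
        / mixingWeight β h N (k N) (j N) m)) atTop
      (𝓝 (W * ∫ s : ℝ, Real.exp (β * δ * s
        - (β - (1 - α) * (β ^ 2 * (1 - m ^ 2))) / 2 * s ^ 2))) := by
  set x₀ := β * m + h
  obtain ⟨g, hg, hgeq⟩ := exists_tangentExcess_eq x₀
  rw [← hm] at hg
  have hsN : Tendsto (fun N : ℕ => √(N : ℝ)) atTop atTop :=
    Real.tendsto_sqrt_atTop.comp tendsto_natCast_atTop_atTop
  set e : ℕ → ℝ → ℝ := fun N s => β * s * ((2 * j N - k N - k N * m) / √N)
    + (N - k N) * tangentExcess x₀ (β * (s / √N)) - β / 2 * s ^ 2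
  have key : Tendsto (fun N : ℕ => ∫ s, w N (m + s / √N) * Real.exp (e N s)) atTop
      (𝓝 (∫ s : ℝ, W * Real.exp (β * δ * s
        - (β - (1 - α) * (β ^ 2 * (1 - m ^ 2))) / 2 * s ^ 2))) := by
    -- An eventual bound for the linear coefficient. The sum of the two exponentials below dominates
    -- the exponential of `|β D s|`, whatever the sign of `s`.
    set D := |δ| + 1
    refine tendsto_integral_filter_of_dominated_convergence
      (fun s => C * (Real.exp (β * D * s - c * s ^ 2) + Real.exp (-(β * D) * s - c * s ^ 2)))
      ?_ ?_ ?_ ?_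
    · refine Eventually.of_forall fun N => ?_
      have h1 : Measurable (tangentExcess x₀) := (continuous_tangentExcess x₀).measurable
      have h2 : Measurable fun s : ℝ => w N (m + s / √N) := (hwm N).comp (by fun_prop)
      have h3 : Measurable fun s : ℝ => tangentExcess x₀ (β * (s / √N)) := h1.comp (by fun_prop)
      have h4 : Measurable (e N) := by simp only [e]; fun_prop
      exact (h2.mul h4.exp).aestronglyMeasurable
    · have hD : ∀ᶠ N : ℕ in atTop, |(2 * j N - k N - k N * m : ℝ) / √N| ≤ D :=
        (hδ.abs.eventually (gt_mem_nhds (lt_add_one |δ|))).mono fun N hN => hN.le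
      filter_upwards [hkN, hwC, hD, eventually_gt_atTop 0] with N h1 h2 h3 h4
      refine ae_of_all _ fun s => ?_
      have hN' : (0 : ℝ) < N := by exact_mod_cast h4
      have hC : 0 ≤ C := (abs_nonneg _).trans (h2 0)
      rw [Real.norm_eq_abs, abs_mul, Real.abs_exp]
      by_cases hE : s / √N ∈ E
      · refine mul_le_mul (h2 _) ?_ (Real.exp_pos _).le hC
        have h5 := hgap _ hE
        -- Nonnegativity of the excess lets `N - k` be replaced by `N`, so the dominating function
        -- does not depend on `k`.
        have h6 : ((N : ℝ) - k N) * tangentExcess x₀ (β * (s / √N)) ≤ (β / 2 - c) * s ^ 2 := by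
          calc ((N : ℝ) - k N) * tangentExcess x₀ (β * (s / √N))
              ≤ N * tangentExcess x₀ (β * (s / √N)) := by
                refine mul_le_mul_of_nonneg_right ?_ (tangentExcess_nonneg _ _)
                linarith [(Nat.cast_nonneg (k N) : (0 : ℝ) ≤ k N)]
            _ ≤ N * ((β / 2 - c) * (s / √N) ^ 2) := mul_le_mul_of_nonneg_left h5 hN'.le
            _ = (β / 2 - c) * s ^ 2 := by
                rw [div_pow, Real.sq_sqrt hN'.le]
                field_simp
        have h7 : β * s * ((2 * j N - k N - k N * m) / √N) ≤ |β * D * s| := by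
          refine (le_abs_self _).trans ?_
          rw [abs_mul, abs_mul, abs_mul, abs_mul, abs_of_nonneg (by positivity : 0 ≤ D)]
          have := mul_le_mul_of_nonneg_left h3 (by positivity : 0 ≤ |β| * |s|)
          linarith
        have h8 : e N s ≤ |β * D * s| - c * s ^ 2 := by
          simp only [e]
          linarith
        rcases abs_choice (β * D * s) with h9 | h9
        · rw [h9] at h8
          exact (Real.exp_le_exp.2 h8).trans (le_add_of_nonneg_right (Real.exp_pos _).le)
        · rw [h9, ← neg_mul] at h8
          exact (Real.exp_le_exp.2 h8).trans (le_add_of_nonneg_left (Real.exp_pos _).le)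
      · rw [hwE N _ (by rwa [add_sub_cancel_left]), abs_zero, zero_mul]
        positivity
    · exact ((integrable_exp_quadratic hc _).add (integrable_exp_quadratic hc _)).const_mul C
    · refine ae_of_all _ fun s => (hw s).mul ((Real.continuous_exp.tendsto _).comp ?_)
      have h1 : Tendsto (fun N : ℕ => β * (s / √N)) atTop (𝓝 0) := by
        simpa using (hsN.const_div_atTop s).const_mul β
      have h2 := (((hδ.const_mul (β * s)).add (((hkα.const_sub 1).mul_const
        (β ^ 2 * s ^ 2)).mul (hg.comp h1))).sub_const (β / 2 * s ^ 2))
      have e1 : β * s * δ + (1 - α) * (β ^ 2 * s ^ 2) * ((1 - m ^ 2) / 2) - β / 2 * s ^ 2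
          = β * δ * s - (β - (1 - α) * (β ^ 2 * (1 - m ^ 2))) / 2 * s ^ 2 := by ring
      rw [e1] at h2
      refine h2.congr' ?_
      filter_upwards [eventually_gt_atTop 0] with N hN
      have hN' : (0 : ℝ) < N := by exact_mod_cast hN
      simp only [e, Function.comp_apply, hgeq, mul_pow, div_pow, Real.sq_sqrt hN'.le]
      field_simp
  rw [integral_const_mul] at key
  refine key.congr' ?_
  filter_upwards [hkN, eventually_gt_atTop 0] with N h1 h2
  have h3 := mixingWeight_pos β h N (k N) (j N) m
  rw [← mul_div_assoc, ← integral_comp_add_div_sqrt N _ m, ← integral_div]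
  refine integral_congr_ae (ae_of_all _ fun s => ?_)
  simp only
  rw [mixingWeight_add hm h1, rescaled_exponent_eq h2]
  simp only [e, x₀]
  field_simp

/-! ### The local limit theorem for the number of positive spins -/

/-- At `y = m` the spins are independent with plus-probability `exp x₀ / (2 cosh x₀) = (1 + m) / 2`,
and the Gaussian factors cancel; no asymptotics are involved. -/
theorem choose_mul_mixingWeight_div {β h m : ℝ} (hm : m = Real.tanh (β * m + h)) {N k : ℕ}
    (hkN : k ≤ N) (j : ℕ) :
    (k.choose j : ℝ) * (mixingWeight β h N k j m / mixingWeight β h N 0 0 m)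
      = binomialMass k ((1 + m) / 2) j := by
  rcases lt_or_ge k j with hj | hj
  · rw [binomialMass_eq_zero hj, Nat.choose_eq_zero_of_lt hj, Nat.cast_zero, zero_mul]
  set x₀ := β * m + h with hx₀
  have hc := Real.cosh_pos x₀
  have hp : (1 + m) / 2 = Real.exp x₀ / (2 * Real.cosh x₀) := by
    rw [hm, Real.tanh_eq_sinh_div_cosh, ← Real.cosh_add_sinh]
    field_simp
  have hq : 1 - (1 + m) / 2 = Real.exp (-x₀) / (2 * Real.cosh x₀) := by
    rw [hm, Real.tanh_eq_sinh_div_cosh, ← Real.cosh_sub_sinh]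
    field_simp
    ring
  rw [binomialMass, hq, hp, mixingWeight, mixingWeight, ← hx₀, mul_assoc (k.choose j : ℝ)]
  congr 1
  obtain ⟨i, rfl⟩ := Nat.exists_eq_add_of_le hj
  obtain ⟨l, rfl⟩ := Nat.exists_eq_add_of_le hkN
  rw [Nat.add_sub_cancel_left, Nat.add_sub_cancel_left, Nat.sub_zero, div_pow, div_pow,
    ← Real.exp_nat_mul, ← Real.exp_nat_mul]
  have e1 : Real.exp (x₀ * (2 * j - (j + i : ℕ)))
      = Real.exp (j * x₀) * Real.exp (i * -x₀) := by
    rw [← Real.exp_add]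
    congr 1
    push_cast
    ring
  rw [e1, pow_add, pow_add]
  simp only [Nat.cast_zero, mul_zero, sub_zero, Real.exp_zero, one_mul]
  field_simp

/-- Both integrals are explicit. The ratio of their normalisations and the square completed in the
numerator jointly turn the variance `w / 4` into the enlarged one. -/
theorem gaussianPDFReal_mul_gaussian_ratio {β w α t : ℝ} (hβ : 0 < β) (hw : 0 < w) (hα : 0 ≤ α)
    (hβw : β * w < 1) :
    gaussianPDFReal 0 (w / 4).toNNReal t *
      ((∫ s : ℝ, Real.exp (β * (2 * t * √α) * s - (β - (1 - α) * (β ^ 2 * w)) / 2 * s ^ 2))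
        / ∫ s : ℝ, Real.exp (β * 0 * s - (β - (1 - 0) * (β ^ 2 * w)) / 2 * s ^ 2))
      = gaussianPDFReal 0 (w / 4 * (1 + α * β * w / (1 - β * w))).toNNReal t := by
  set r := 1 - β * w with hr
  have hr0 : 0 < r := sub_pos.2 hβw
  have hpi := Real.pi_pos
  have hA : β - (1 - α) * (β ^ 2 * w) = β * (r + α * β * w) := by rw [hr]; ring
  have hA0 : β - (1 - 0) * (β ^ 2 * w) = β * r := by rw [hr]; ring
  have hB : 0 < r + α * β * w := by positivity
  rw [hA, hA0, integral_exp_quadratic (by positivity), integral_exp_quadratic (by positivity),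
    gaussianPDFReal, gaussianPDFReal, Real.coe_toNNReal _ (by positivity),
    Real.coe_toNNReal _ (by positivity), mul_zero, zero_pow two_ne_zero, zero_div, Real.exp_zero,
    mul_one, sub_zero]
  have e1 : (√(2 * Real.pi * (w / 4)))⁻¹ * (√(Real.pi / (β * (r + α * β * w) / 2))
      / √(Real.pi / (β * r / 2))) = (√(2 * Real.pi * (w / 4 * (1 + α * β * w / r))))⁻¹ := by
    rw [← Real.sqrt_inv, ← Real.sqrt_inv, ← Real.sqrt_div (by positivity),
      ← Real.sqrt_mul (by positivity)]
    congr 1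
    field_simp
  have e2 : -t ^ 2 / (2 * (w / 4)) + (β * (2 * t * √α)) ^ 2 / (4 * (β * (r + α * β * w) / 2))
      = -t ^ 2 / (2 * (w / 4 * (1 + α * β * w / r))) := by
    have : (β * (2 * t * √α)) ^ 2 = 4 * β ^ 2 * t ^ 2 * α := by
      rw [mul_pow, mul_pow, mul_pow, Real.sq_sqrt hα]; ring
    rw [this]
    field_simp
    ring
  rw [← e1, ← e2, Real.exp_add]
  ring

/-- The mass is the exact binomial mass at `y = m` times a ratio of Laplace integrals. The limits
`W` and `W'` record the local weight of the maximiser in numerator and denominator. -/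
theorem tendsto_sqrt_mul_choose_mul_ratio {β h m α c C C' W W' t : ℝ} {E : Set ℝ} {k j : ℕ → ℕ}
    {w w' : ℕ → ℝ → ℝ} (hβ : 0 < β) (hm : m = Real.tanh (β * m + h))
    (hc : 0 < c) (hE : E ∈ 𝓝 0) (hgap : HasQuadraticGap β (β * m + h) c E)
    (hα : 0 ≤ α) (hkN : ∀ᶠ N in atTop, k N ≤ N) (hk : Tendsto k atTop atTop)
    (hkα : Tendsto (fun N : ℕ => (k N : ℝ) / N) atTop (𝓝 α))
    (hj : Tendsto (fun N => ((j N : ℝ) - k N * ((1 + m) / 2)) / √(k N)) atTop (𝓝 t))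
    (hwm : ∀ N, Measurable (w N)) (hwC : ∀ᶠ N in atTop, ∀ y, |w N y| ≤ C)
    (hwE : ∀ N y, y - m ∉ E → w N y = 0)
    (hw : ∀ s, Tendsto (fun N : ℕ => w N (m + s / √N)) atTop (𝓝 W))
    (hwm' : ∀ N, Measurable (w' N)) (hwC' : ∀ᶠ N in atTop, ∀ y, |w' N y| ≤ C')
    (hwE' : ∀ N y, y - m ∉ E → w' N y = 0)
    (hw' : ∀ s, Tendsto (fun N : ℕ => w' N (m + s / √N)) atTop (𝓝 W')) (hW' : W' ≠ 0) :
    Tendsto (fun N : ℕ => √(k N) * ((k N).choose (j N) *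
        ((∫ y, w N y * mixingWeight β h N (k N) (j N) y)
          / ∫ y, w' N y * mixingWeight β h N 0 0 y))) atTop
      (𝓝 (W / W' * gaussianPDFReal 0 ((1 - m ^ 2) / 4 * (1 + α * β * (1 - m ^ 2)
        / (1 - β * (1 - m ^ 2)))).toNNReal t)) := by
  have hm1 : |m| < 1 := by rw [hm]; exact Real.abs_tanh_lt_one _
  have hm2 := abs_lt.1 hm1
  have hwpos : 0 < 1 - m ^ 2 := by
    have := (sq_lt_one_iff_abs_lt_one m).2 hm1
    linarith
  have hβw : β * (1 - m ^ 2) < 1 := by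
    have h1 := hgap.mul_lt_one hE
    rw [← hm] at h1
    by_contra h2
    have := mul_le_mul_of_nonneg_left (not_lt.1 h2) hβ.le
    linarith
  -- The deviation is about `2 t √k`, and `√k / √N` tends to `√α`.
  have hδ : Tendsto (fun N : ℕ => (2 * j N - k N - k N * m : ℝ) / √N) atTop
      (𝓝 (2 * t * √α)) := by
    refine ((hj.const_mul 2).mul ((Real.continuous_sqrt.tendsto _).comp hkα)).congr' ?_
    filter_upwards [hk.eventually_gt_atTop 0] with N hN
    have hk' : (0 : ℝ) < k N := by exact_mod_cast hN
    rw [Function.comp_apply, Real.sqrt_div hk'.le]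
    field_simp
    ring
  have hnum := tendsto_integral_mul_mixingWeight hβ hm hc hgap hkN hkα hδ hwm hwC hwE hw
  -- The normalising integral is the case with no prescribed spins.
  have hden := tendsto_integral_mul_mixingWeight (k := fun _ => 0) (j := fun _ => 0) (α := 0)
    (δ := 0) hβ hm hc hgap (Eventually.of_forall fun N => Nat.zero_le N) (by simp)
    (by simp) hwm' hwC' hwE' hw'
  have hpos : 0 < ∫ s : ℝ, Real.exp (β * 0 * s
      - (β - (1 - 0) * (β ^ 2 * (1 - m ^ 2))) / 2 * s ^ 2) := by
    have h1 : β - (1 - 0) * (β ^ 2 * (1 - m ^ 2)) = β * (1 - β * (1 - m ^ 2)) := by ring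
    have h2 : 0 < 1 - β * (1 - m ^ 2) := sub_pos.2 hβw
    have hpi := Real.pi_pos
    rw [h1, integral_exp_quadratic (by positivity)]
    positivity
  have hbin := tendsto_sqrt_mul_binomialMass (p := (1 + m) / 2) (by linarith) (by linarith) hk hj
  have hall := hbin.mul (hnum.div hden (mul_ne_zero hW' hpos.ne'))
  have hval := gaussianPDFReal_mul_gaussian_ratio (t := t) hβ hwpos hα hβw
  have e1 : (1 + m) / 2 * (1 - (1 + m) / 2) = (1 - m ^ 2) / 4 := by ring
  rw [e1, mul_div_mul_comm, mul_left_comm, hval] at hall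
  refine hall.congr' ?_
  filter_upwards [hkN, eventually_gt_atTop 0] with N h1 h2
  have hN' : (0 : ℝ) < N := by exact_mod_cast h2
  have h3 := mixingWeight_pos β h N (k N) (j N) m
  have h4 := mixingWeight_pos β h N 0 0 m
  have h5 : 0 < √(N : ℝ) := Real.sqrt_pos.2 hN'
  rw [← choose_mul_mixingWeight_div hm h1, Pi.div_apply, mul_div_mul_left _ _ h5.ne']
  field_simp

/-! ### Binomial laws as finite sums -/

theorem binomialLaw_real (n : ℕ) (p : unitInterval) {A : Set ℝ} (hA : MeasurableSet A) :
    (binomialLaw n p).real A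
      = ∑ j ∈ Finset.range (n + 1), A.indicator 1 (j : ℝ) * binomialMass n p j := by
  have hmass : ∀ j, (binomial n p).real {j} = binomialMass n p j := fun j =>
    binomial_real_singleton n j p
  set R := Finset.range (n + 1)
  have hR : (binomial n p).real (R : Set ℕ)ᶜ = 0 := by
    rw [probReal_compl_eq_one_sub R.measurableSet, ← sum_measureReal_singleton]
    simp only [hmass, R, sum_binomialMass, sub_self]
  set B : Set ℕ := (Nat.cast : ℕ → ℝ) ⁻¹' A
  classical
  have hB : (binomial n p).real B = (binomial n p).real ((R.filter (· ∈ B) : Finset ℕ) : Set ℕ) := by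
    rw [← measureReal_inter_add_sdiff (s := B) R.measurableSet,
      measureReal_mono_null (show B \ (R : Set ℕ) ⊆ (R : Set ℕ)ᶜ from fun _ hx => hx.2) hR, add_zero]
    congr 1
    ext j
    simp [and_comm]
  rw [binomialLaw, map_measureReal_apply (by fun_prop) hA]
  change (binomial n p).real B = _
  rw [hB, ← sum_measureReal_singleton, Finset.sum_filter]
  refine Finset.sum_congr rfl fun j _ => ?_
  rw [hmass]
  by_cases hj : (j : ℝ) ∈ A
  · rw [if_pos (by exact hj), Set.indicator_of_mem hj, Pi.one_apply, one_mul]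
  · rw [if_neg (by exact hj), Set.indicator_of_notMem hj, zero_mul]

theorem mixedBinomialLaw_two_point_real (n : ℕ) (p q : unitInterval) {A : Set ℝ}
    (hA : MeasurableSet A) :
    (mixedBinomialLaw n ((1 / 2 : ℝ≥0∞) • (Measure.dirac p + Measure.dirac q))).real A
      = ∑ j ∈ Finset.range (n + 1), A.indicator 1 (j : ℝ) *
        ((binomialMass n p j + binomialMass n q j) / 2) := by
  have hmass : ∀ (p : unitInterval) (j : ℕ), (binomial n p {j}).toReal = binomialMass n p j :=
    fun p j => binomial_real_singleton n j p
  rw [mixedBinomialLaw, measureReal_def, Measure.finsetSum_apply]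
  simp only [lintegral_smul_measure, lintegral_add_measure, lintegral_dirac, Measure.smul_apply,
    smul_eq_mul, Measure.dirac_apply' _ hA]
  rw [ENNReal.toReal_sum]
  · refine Finset.sum_congr rfl fun j _ => ?_
    rw [ENNReal.toReal_mul, ENNReal.toReal_mul, ENNReal.toReal_add (measure_ne_top _ _)
      (measure_ne_top _ _), hmass, hmass]
    by_cases hj : (j : ℝ) ∈ A
    · simp [hj]; ring
    · simp [hj]
  · intro j _
    refine ENNReal.mul_ne_top (ENNReal.mul_ne_top (by simp) (ENNReal.add_ne_top.2
      ⟨measure_ne_top _ _, measure_ne_top _ _⟩)) ?_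
    by_cases hj : (j : ℝ) ∈ A <;> simp [hj]

/-! ### The limit of the total variation distance: a single phase -/

theorem gaussD_mul_eq_zero_iff {β w α : ℝ} (hβ : 0 < β) (hw : 0 < w) (hα : 0 ≤ α)
    (hβw : β * w < 1) :
    gaussD (w / 4 * (1 + α * β * w / (1 - β * w))) (w / 4) = 0 ↔ α = 0 := by
  have hr : 0 < 1 - β * w := sub_pos.2 hβw
  rw [gaussD_eq_zero_iff (by positivity) (by positivity), mul_eq_left₀ (by positivity),
    add_eq_left, div_eq_zero_iff]
  constructor
  · rintro (h | h)
    · simpa [hβ.ne', hw.ne'] using h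
    · exact absurd h hr.ne'
  · rintro rfl
    simp

theorem tendsto_tvDist_binomialLaw {β h m α c : ℝ} {k : ℕ → ℕ} {p : unitInterval} (hβ : 0 < β)
    (hm : m = Real.tanh (β * m + h)) (hp : (p : ℝ) = (1 + m) / 2)
    (hc : 0 < c) (hgap : HasQuadraticGap β (β * m + h) c Set.univ)
    (hα : 0 ≤ α) (hkN : ∀ᶠ N in atTop, k N ≤ N) (hk : Tendsto k atTop atTop)
    (hkα : Tendsto (fun N : ℕ => (k N : ℝ) / N) atTop (𝓝 α)) :
    Tendsto (fun N : ℕ => tvDist (posSpinsLaw β h N (k N)) (binomialLaw (k N) p)) atTop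
        (𝓝 (gaussD ((1 - m ^ 2) / 4 * (1 + α * β * (1 - m ^ 2) / (1 - β * (1 - m ^ 2))))
          ((1 - m ^ 2) / 4))) ∧
      (gaussD ((1 - m ^ 2) / 4 * (1 + α * β * (1 - m ^ 2) / (1 - β * (1 - m ^ 2))))
          ((1 - m ^ 2) / 4) = 0 ↔ α = 0) := by
  have hm1 : |m| < 1 := by rw [hm]; exact Real.abs_tanh_lt_one _
  have hm2 := abs_lt.1 hm1
  have hw : 0 < 1 - m ^ 2 := by
    have := (sq_lt_one_iff_abs_lt_one m).2 hm1
    linarith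
  have hβw : β * (1 - m ^ 2) < 1 := by
    have h1 := hgap.mul_lt_one univ_mem
    rw [← hm] at h1
    by_contra h2
    have := mul_le_mul_of_nonneg_left (not_lt.1 h2) hβ.le
    linarith
  have hr : 0 < 1 - β * (1 - m ^ 2) := sub_pos.2 hβw
  refine ⟨?_, gaussD_mul_eq_zero_iff hβ hw hα hβw⟩
  have hp0 : 0 < (1 + m) / 2 := by linarith
  have hgood : ∀ᶠ N in atTop, 0 < N ∧ k N ≤ N := (eventually_gt_atTop 0).and hkN
  have hmain := tendsto_half_sum_abs_sub (a := fun N => posSpinsMass β h N (k N))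
    (b := fun N => binomialMass (k N) ((1 + m) / 2)) (p := (1 + m) / 2)
    (v₁ := (1 - m ^ 2) / 4 * (1 + α * β * (1 - m ^ 2) / (1 - β * (1 - m ^ 2))))
    (v₂ := (1 - m ^ 2) / 4) hk (by positivity) (by positivity)
    (hgood.mono fun N hN => posSpinsMass_nonneg hβ h hN.1 hN.2)
    (Eventually.of_forall fun N j hj => posSpinsMass_eq_zero β h N hj)
    (hgood.mono fun N hN => sum_posSpinsMass hβ h hN.1 hN.2)
    (Eventually.of_forall fun N => binomialMass_nonneg hp0.le (by linarith) (k N))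
    (Eventually.of_forall fun N j hj => binomialMass_eq_zero hj _)
    (Eventually.of_forall fun N => sum_binomialMass _ _)
    (fun t => by
      rw [tendsto_congr' (latticeDensity_eventuallyEq hk hp0 t _)]
      have := tendsto_sqrt_mul_choose_mul_ratio (w := fun _ _ => 1) (w' := fun _ _ => 1) (C := 1)
        (C' := 1) (W := 1) (W' := 1) hβ hm hc univ_mem hgap hα hkN hk hkα (tendsto_cell hk hp0 t)
        (fun _ => measurable_const) (by simp) (by simp) (fun _ => tendsto_const_nhds)
        (fun _ => measurable_const) (by simp) (by simp) (fun _ => tendsto_const_nhds) one_ne_zero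
      simpa only [one_mul, div_one, posSpinsMass] using this)
    (fun t => by
      rw [tendsto_congr' (latticeDensity_eventuallyEq hk hp0 t _)]
      have := tendsto_sqrt_mul_binomialMass hp0 (by linarith) hk (tendsto_cell hk hp0 t)
      rwa [show (1 + m) / 2 * (1 - (1 + m) / 2) = (1 - m ^ 2) / 4 by ring] at this)
  refine hmain.congr' ?_
  filter_upwards [hgood] with N hN
  rw [tvDist_eq_half_sum (fun A hA => posSpinsLaw_real hβ h hN.1 hN.2 hA)
    (fun A hA => binomialLaw_real (k N) p hA)
    (by rw [sum_posSpinsMass hβ h hN.1 hN.2, sum_binomialMass]), hp]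

/-! ### Symmetric laws folded onto the upper half of their support -/

/-- The mass function on `{j | k ≤ 2 j}` obtained from `a` by reflection in `k / 2`. -/
def fold (k : ℕ) (a : ℕ → ℝ) (j : ℕ) : ℝ :=
  if k < 2 * j then 2 * a j else if 2 * j = k then a j else 0

theorem fold_nonneg {k : ℕ} {a : ℕ → ℝ} (ha : ∀ j, 0 ≤ a j) (j : ℕ) : 0 ≤ fold k a j := by
  have := ha j
  unfold fold
  split_ifs <;> linarith

theorem fold_eq_zero {k : ℕ} {a : ℕ → ℝ} {j : ℕ} (ha : a j = 0) : fold k a j = 0 := by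
  unfold fold
  split_ifs <;> simp [ha]

theorem abs_fold_sub (k : ℕ) (a b : ℕ → ℝ) (j : ℕ) :
    |fold k a j - fold k b j| = fold k (fun j => |a j - b j|) j := by
  unfold fold
  split_ifs
  · rw [← mul_sub, abs_mul, abs_two]
  · rfl
  · simp

theorem sum_fold {k : ℕ} {a : ℕ → ℝ} (ha : ∀ j ≤ k, a (k - j) = a j) :
    ∑ j ∈ Finset.range (k + 1), fold k a j = ∑ j ∈ Finset.range (k + 1), a j := by
  have h1 : ∑ j ∈ Finset.range (k + 1), (if k < 2 * j then a j else 0)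
      = ∑ j ∈ Finset.range (k + 1), (if 2 * j < k then a j else 0) := by
    rw [← Finset.sum_range_reflect]
    refine Finset.sum_congr rfl fun j hj => ?_
    have hj' : j ≤ k := Nat.lt_succ_iff.1 (Finset.mem_range.1 hj)
    rw [show k + 1 - 1 - j = k - j by omega, ha j hj']
    exact if_congr (by omega) rfl rfl
  have h2 : ∀ j, fold k a j = (if k < 2 * j then a j else 0) - (if 2 * j < k then a j else 0)
      + a j := by
    intro j
    unfold fold
    rcases lt_trichotomy k (2 * j) with h | h | h
    · rw [if_pos h, if_pos h, if_neg (by omega)]; ring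
    · rw [if_neg (by omega), if_pos h.symm, if_neg (by omega), if_neg (by omega)]; ring
    · rw [if_neg (by omega), if_neg (by omega), if_neg (by omega), if_pos h]; ring
  simp only [h2]
  rw [Finset.sum_add_distrib, Finset.sum_sub_distrib, h1, sub_self, zero_add]

/-! ### The limit of the total variation distance: two symmetric phases -/

theorem mixingWeight_neg (β : ℝ) (N k j : ℕ) (y : ℝ) :
    mixingWeight β 0 N k j (-y)
      = Real.exp (-(2 * β * y * (2 * j - k))) * mixingWeight β 0 N k j y := by
  unfold mixingWeight
  rw [mul_neg, add_zero, add_zero, Real.cosh_neg, neg_sq, ← mul_assoc, ← mul_assoc, ← Real.exp_add]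
  congr 3
  ring

theorem mixingWeight_sub {k j : ℕ} (hj : j ≤ k) (β : ℝ) (N : ℕ) (y : ℝ) :
    mixingWeight β 0 N k (k - j) y = mixingWeight β 0 N k j (-y) := by
  unfold mixingWeight
  rw [mul_neg, add_zero, add_zero, Real.cosh_neg, neg_sq, Nat.cast_sub hj]
  congr 3
  ring

theorem posSpinsMass_sub {k j : ℕ} (hj : j ≤ k) (β : ℝ) (N : ℕ) :
    posSpinsMass β 0 N k (k - j) = posSpinsMass β 0 N k j := by
  unfold posSpinsMass
  simp only [mixingWeight_sub hj]
  rw [integral_neg_eq_self (mixingWeight β 0 N k j), Nat.choose_symm hj]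

theorem binomialMass_sub {k j : ℕ} (hj : j ≤ k) (p : ℝ) :
    binomialMass k p (k - j) = binomialMass k (1 - p) j := by
  unfold binomialMass
  rw [Nat.choose_symm hj, Nat.sub_sub_self hj, sub_sub_cancel]
  ring

/-- Exchanging the two success probabilities costs a power of the odds. For `p > 1 / 2` this makes
the other mixture component negligible once `2 j - k` is large. -/
theorem binomialMass_one_sub {k j : ℕ} (hj : k ≤ 2 * j) {p : ℝ} (hp : p ≠ 0) :
    binomialMass k (1 - p) j = binomialMass k p j * ((1 - p) / p) ^ (2 * j - k) := by
  rcases lt_or_ge k j with h | h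
  · rw [binomialMass_eq_zero h, binomialMass_eq_zero h, zero_mul]
  obtain ⟨i, rfl⟩ := Nat.exists_eq_add_of_le h
  obtain ⟨d, rfl⟩ := Nat.exists_eq_add_of_le (show i ≤ j by omega)
  unfold binomialMass
  rw [Nat.add_sub_cancel_left, sub_sub_cancel, show 2 * (i + d) - (i + d + i) = d by omega,
    div_pow, pow_add, pow_add]
  field_simp

theorem integrable_mixingWeight {β : ℝ} (hβ : 0 < β) {N k : ℕ} (hN : 0 < N) (hkN : k ≤ N)
    (j : ℕ) : Integrable (mixingWeight β 0 N k j) := by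
  have hN' : (0 : ℝ) < N := by exact_mod_cast hN
  have hb : 0 < N * β / 2 := by positivity
  have hkN' : (0 : ℝ) ≤ N - k := sub_nonneg.2 (by exact_mod_cast hkN)
  set D : ℝ := β * |(2 * j - k : ℝ)| + (N - k) * β
  refine Integrable.mono' (((integrable_exp_quadratic hb D).add
    (integrable_exp_quadratic hb (-D))).const_mul (mixingWeight β 0 N k j 0))
    (measurable_mixingWeight β 0 N k j).aestronglyMeasurable (ae_of_all _ fun z => ?_)
  have h0 := mixingWeight_pos β 0 N k j 0
  have hz := mixingWeight_add (β := β) (h := 0) (m := 0) (by simp) hkN j z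
  rw [Real.norm_eq_abs, abs_of_pos (mixingWeight_pos _ _ _ _ _ _)]
  rw [zero_add] at hz
  rw [hz]
  refine mul_le_mul_of_nonneg_left ?_ h0.le
  have h1 : tangentExcess (β * 0 + 0) (β * z) ≤ β * |z| := by
    have := log_cosh_le_abs (β * z)
    rw [abs_mul, abs_of_pos hβ] at this
    simpa [tangentExcess] using this
  have h2 : β * z * (2 * j - k - k * 0) ≤ β * |(2 * j - k : ℝ)| * |z| := by
    refine (le_abs_self _).trans (le_of_eq ?_)
    rw [mul_zero, sub_zero, abs_mul, abs_mul, abs_of_pos hβ]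
    ring
  have h3 := mul_le_mul_of_nonneg_left h1 hkN'
  have h4 : β * z * (2 * j - k - k * 0) + (N - k) * tangentExcess (β * 0 + 0) (β * z)
      - N * β / 2 * z ^ 2 ≤ D * |z| - N * β / 2 * z ^ 2 := by
    simp only [D, add_mul]
    linarith
  rcases abs_choice z with h | h <;> rw [h] at h4
  · exact (Real.exp_le_exp.2 h4).trans (le_add_of_nonneg_right (Real.exp_pos _).le)
  · rw [mul_neg, ← neg_mul] at h4
    exact (Real.exp_le_exp.2 h4).trans (le_add_of_nonneg_left (Real.exp_pos _).le)

/-- The weight on the half-line `y > 0` by which, for `h = 0`, the integral of `mixingWeight` is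
reduced to that half-line. -/
def reflectionWeight (β : ℝ) (k j : ℕ) : ℝ → ℝ :=
  (Set.Ioi 0).indicator fun y => 1 + Real.exp (-(2 * β * y * (2 * j - k)))

theorem measurable_reflectionWeight (β : ℝ) (k j : ℕ) : Measurable (reflectionWeight β k j) :=
  Measurable.indicator (by fun_prop) measurableSet_Ioi

theorem abs_reflectionWeight_le {β : ℝ} (hβ : 0 < β) {k j : ℕ} (hj : k ≤ 2 * j) (y : ℝ) :
    |reflectionWeight β k j y| ≤ 2 := by
  unfold reflectionWeight
  by_cases hy : y ∈ Set.Ioi (0 : ℝ)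
  · have hj' : (0 : ℝ) ≤ 2 * j - k := sub_nonneg.2 (by exact_mod_cast hj)
    have hy' : 0 < y := hy
    have h1 : Real.exp (-(2 * β * y * (2 * j - k))) ≤ 1 := by
      rw [Real.exp_le_one_iff, neg_nonpos]
      positivity
    rw [Set.indicator_of_mem hy, abs_of_pos (by positivity)]
    linarith
  · rw [Set.indicator_of_notMem hy, abs_zero]
    norm_num

/-- Pairing `y` with `-y` removes the second maximiser, leaving a range on which the quadratic gap
holds. -/
theorem integral_mixingWeight_eq {β : ℝ} (hβ : 0 < β) {N k : ℕ} (hN : 0 < N) (hkN : k ≤ N)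
    (j : ℕ) : ∫ y, mixingWeight β 0 N k j y
      = ∫ y, reflectionWeight β k j y * mixingWeight β 0 N k j y := by
  have hi := integrable_mixingWeight hβ hN hkN j
  have h1 : ∀ y, reflectionWeight β k j y * mixingWeight β 0 N k j y
      = (Set.Ioi 0).indicator
          (fun y => mixingWeight β 0 N k j y + mixingWeight β 0 N k j (-y)) y := by
    intro y
    unfold reflectionWeight
    by_cases hy : y ∈ Set.Ioi (0 : ℝ)
    · rw [Set.indicator_of_mem hy, Set.indicator_of_mem hy, mixingWeight_neg]
      ring
    · rw [Set.indicator_of_notMem hy, Set.indicator_of_notMem hy, zero_mul]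
  simp only [h1]
  rw [integral_indicator measurableSet_Ioi, integral_add hi.integrableOn hi.comp_neg.integrableOn,
    integral_comp_neg_Ioi 0 (mixingWeight β 0 N k j), neg_zero, add_comm,
    intervalIntegral.integral_Iic_add_Ioi hi.integrableOn hi.integrableOn]

theorem tendsto_two_mul_sub_atTop {k j : ℕ → ℕ} {m t : ℝ} (hm : 0 < m)
    (hk : Tendsto k atTop atTop)
    (hj : Tendsto (fun N => ((j N : ℝ) - k N * ((1 + m) / 2)) / √(k N)) atTop (𝓝 t)) :
    Tendsto (fun N => (2 * j N - k N : ℝ)) atTop atTop := by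
  have hsk : Tendsto (fun N => √(k N : ℝ)) atTop atTop :=
    Real.tendsto_sqrt_atTop.comp (tendsto_natCast_atTop_atTop.comp hk)
  refine (hsk.atTop_mul_atTop₀ ((hj.const_mul 2).add_atTop (hsk.const_mul_atTop hm))).congr' ?_
  filter_upwards [hk.eventually_gt_atTop 0] with N hN
  have hN' : (0 : ℝ) < k N := by exact_mod_cast hN
  have hs : 0 < √(k N : ℝ) := Real.sqrt_pos.2 hN'
  have h1 : √(k N : ℝ) * (m * √(k N)) = k N * m := by
    rw [mul_left_comm, Real.mul_self_sqrt hN'.le, mul_comm]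
  rw [mul_add, h1]
  field_simp
  ring

/-- Near `y = m` the reflected point contributes a factor exponentially small in `2 j - k`:
observing a large excess of positive spins rules out the negative phase. -/
theorem tendsto_reflectionWeight {β m : ℝ} (hβ : 0 < β) (hm : 0 < m) {k j : ℕ → ℕ}
    (hjk : Tendsto (fun N => (2 * j N - k N : ℝ)) atTop atTop) (s : ℝ) :
    Tendsto (fun N : ℕ => reflectionWeight β (k N) (j N) (m + s / √N)) atTop (𝓝 1) := by
  have hsN : Tendsto (fun N : ℕ => √(N : ℝ)) atTop atTop :=
    Real.tendsto_sqrt_atTop.comp tendsto_natCast_atTop_atTop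
  have hy : Tendsto (fun N : ℕ => m + s / √(N : ℝ)) atTop (𝓝 m) := by
    simpa using (hsN.const_div_atTop s).const_add m
  have h1 : Tendsto (fun N : ℕ => 2 * β * (m + s / √(N : ℝ)) * (2 * j N - k N)) atTop atTop :=
    (hy.const_mul (2 * β)).pos_mul_atTop (by positivity) hjk
  have h2 := (Real.tendsto_exp_neg_atTop_nhds_zero.comp h1).const_add 1
  rw [add_zero] at h2
  refine h2.congr' ?_
  filter_upwards [hy.eventually (lt_mem_nhds hm)] with N hN
  rw [reflectionWeight, Set.indicator_of_mem (Set.mem_Ioi.2 hN)]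
  rfl

/-- With no spins observed both phases count equally. The ratio of the limits `1` and `2` is the
probability `1 / 2` of the positive phase. -/
theorem tendsto_reflectionWeight_zero {β m : ℝ} (hm : 0 < m) (s : ℝ) :
    Tendsto (fun N : ℕ => reflectionWeight β 0 0 (m + s / √N)) atTop (𝓝 2) := by
  have hsN : Tendsto (fun N : ℕ => √(N : ℝ)) atTop atTop :=
    Real.tendsto_sqrt_atTop.comp tendsto_natCast_atTop_atTop
  have hy : Tendsto (fun N : ℕ => m + s / √(N : ℝ)) atTop (𝓝 m) := by
    simpa using (hsN.const_div_atTop s).const_add m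
  refine tendsto_const_nhds.congr' ?_
  filter_upwards [hy.eventually (lt_mem_nhds hm)] with N hN
  rw [reflectionWeight, Set.indicator_of_mem (Set.mem_Ioi.2 hN)]
  norm_num

theorem tendsto_sqrt_mul_fold {k j : ℕ → ℕ} {a : ℕ → ℕ → ℝ} {l : ℝ}
    (hjk : Tendsto (fun N => (2 * j N - k N : ℝ)) atTop atTop)
    (ha : Tendsto (fun N => √(k N) * a N (j N)) atTop (𝓝 (1 / 2 * l))) :
    Tendsto (fun N => √(k N) * fold (k N) (a N) (j N)) atTop (𝓝 l) := by
  have h1 := ha.const_mul 2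
  rw [← mul_assoc, mul_one_div_cancel two_ne_zero, one_mul] at h1
  refine h1.congr' ?_
  filter_upwards [hjk.eventually_gt_atTop 0] with N hN
  rw [fold, if_pos (by exact_mod_cast sub_pos.1 hN)]
  ring

/-- Neither law has a single Gaussian limit around one centre, but both are symmetric about `k / 2`.
Folding doubles the upper halves, which restores total mass one around `k (1 + m) / 2` and keeps the
total variation distance. -/
theorem tendsto_tvDist_mixedBinomialLaw {β m α : ℝ} {k : ℕ → ℕ} {p q : unitInterval} (hβ : 0 < β)
    (hm0 : 0 < m) (hm : m = Real.tanh (β * m)) (hp : (p : ℝ) = (1 + m) / 2)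
    (hq : (q : ℝ) = (1 - m) / 2)
    (hα : 0 ≤ α) (hkN : ∀ᶠ N in atTop, k N ≤ N) (hk : Tendsto k atTop atTop)
    (hkα : Tendsto (fun N : ℕ => (k N : ℝ) / N) atTop (𝓝 α)) :
    Tendsto (fun N : ℕ => tvDist (posSpinsLaw β 0 N (k N)) (mixedBinomialLaw (k N)
        ((1 / 2 : ℝ≥0∞) • (Measure.dirac p + Measure.dirac q)))) atTop
        (𝓝 (gaussD ((1 - m ^ 2) / 4 * (1 + α * β * (1 - m ^ 2) / (1 - β * (1 - m ^ 2))))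
          ((1 - m ^ 2) / 4))) ∧
      (gaussD ((1 - m ^ 2) / 4 * (1 + α * β * (1 - m ^ 2) / (1 - β * (1 - m ^ 2))))
          ((1 - m ^ 2) / 4) = 0 ↔ α = 0) := by
  have hm1 : m < 1 := by rw [hm]; exact Real.tanh_lt_one _
  have hw : 0 < 1 - m ^ 2 := by nlinarith
  have hβw : β * (1 - m ^ 2) < 1 := by
    have := mul_one_sub_tanh_sq_lt (mul_pos hβ hm0)
    rw [← hm, mul_right_comm, mul_comm] at this
    exact (mul_lt_iff_lt_one_right hm0).1 this
  have hr : 0 < 1 - β * (1 - m ^ 2) := sub_pos.2 hβw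
  refine ⟨?_, gaussD_mul_eq_zero_iff hβ hw hα hβw⟩
  obtain ⟨c, hc, hgap⟩ := exists_hasQuadraticGap_of_pos hβ hm0 hm
  have hp0 : 0 < (1 + m) / 2 := by linarith
  have hq1 : 1 - (1 + m) / 2 = (1 - m) / 2 := by ring
  have hgood : ∀ᶠ N in atTop, 0 < N ∧ k N ≤ N := (eventually_gt_atTop 0).and hkN
  set b : ℕ → ℕ → ℝ := fun N j =>
    (binomialMass (k N) ((1 + m) / 2) j + binomialMass (k N) ((1 - m) / 2) j) / 2
  have hb0 : ∀ N j, 0 ≤ b N j := fun N j => by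
    have h1 := binomialMass_nonneg hp0.le (by linarith) (k N) j
    have h2 := binomialMass_nonneg (p := (1 - m) / 2) (by linarith) (by linarith) (k N) j
    simp only [b]
    positivity
  have hbs : ∀ N j, k N < j → b N j = 0 := fun N j hj => by
    simp [b, binomialMass_eq_zero hj]
  have hb1 : ∀ N, ∑ j ∈ Finset.range (k N + 1), b N j = 1 := fun N => by
    simp only [b]
    rw [← Finset.sum_div, Finset.sum_add_distrib, sum_binomialMass, sum_binomialMass]
    norm_num
  have hbsymm : ∀ N, ∀ j ≤ k N, b N (k N - j) = b N j := fun N j hj => by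
    simp only [b]
    rw [binomialMass_sub hj, binomialMass_sub hj, add_comm]
    congr 3
    ring
  have hjk : ∀ t, Tendsto (fun N => (2 * cell (k N) ((1 + m) / 2) t - k N : ℝ)) atTop atTop :=
    fun t => tendsto_two_mul_sub_atTop hm0 hk (tendsto_cell hk hp0 t)
  have hjk' : ∀ t, ∀ᶠ N in atTop, k N ≤ 2 * cell (k N) ((1 + m) / 2) t := fun t => by
    filter_upwards [(hjk t).eventually_gt_atTop 0] with N hN
    have := (sub_pos.1 hN).le
    exact_mod_cast this
  have halim : ∀ t, Tendsto (fun N => √(k N) *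
      posSpinsMass β 0 N (k N) (cell (k N) ((1 + m) / 2) t)) atTop
      (𝓝 (1 / 2 * gaussianPDFReal 0 ((1 - m ^ 2) / 4 * (1 + α * β * (1 - m ^ 2)
        / (1 - β * (1 - m ^ 2)))).toNNReal t)) := by
    intro t
    have hE : ∀ (k j : ℕ) (y : ℝ), y - m ∉ Set.Ici (-m) → reflectionWeight β k j y = 0 := by
      intro k j y hy
      rw [Set.mem_Ici, not_le] at hy
      rw [reflectionWeight, Set.indicator_of_notMem]
      rw [Set.mem_Ioi, not_lt]
      linarith
    refine (tendsto_sqrt_mul_choose_mul_ratio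
      (w := fun N => reflectionWeight β (k N) (cell (k N) ((1 + m) / 2) t))
      (w' := fun _ => reflectionWeight β 0 0) hβ (by rwa [add_zero]) hc
      (Ici_mem_nhds (neg_neg_of_pos hm0)) (by rwa [add_zero]) hα hkN hk hkα (tendsto_cell hk hp0 t)
      (fun N => measurable_reflectionWeight _ _ _)
      ((hjk' t).mono fun N hN => abs_reflectionWeight_le hβ hN)
      (fun N y hy => hE _ _ y hy) (tendsto_reflectionWeight hβ hm0 (hjk t))
      (fun N => measurable_reflectionWeight _ _ _)
      (Eventually.of_forall fun N => abs_reflectionWeight_le hβ le_rfl)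
      (fun N y hy => hE _ _ y hy) (tendsto_reflectionWeight_zero hm0) two_ne_zero).congr' ?_
    filter_upwards [hgood] with N hN
    rw [posSpinsMass, integral_mixingWeight_eq hβ hN.1 hN.2,
      integral_mixingWeight_eq hβ hN.1 (Nat.zero_le N)]
  have hblim : ∀ t, Tendsto (fun N => √(k N) * b N (cell (k N) ((1 + m) / 2) t)) atTop
      (𝓝 (1 / 2 * gaussianPDFReal 0 ((1 - m ^ 2) / 4).toNNReal t)) := by
    intro t
    have h1 := tendsto_sqrt_mul_binomialMass hp0 (by linarith) hk (tendsto_cell hk hp0 t)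
    rw [show (1 + m) / 2 * (1 - (1 + m) / 2) = (1 - m ^ 2) / 4 by ring] at h1
    have h2 : Tendsto (fun N => 2 * cell (k N) ((1 + m) / 2) t - k N) atTop atTop := by
      rw [← tendsto_natCast_atTop_iff (R := ℝ)]
      refine (hjk t).congr' ?_
      filter_upwards [hjk' t] with N hN
      rw [Nat.cast_sub hN]
      push_cast
      rfl
    have h3 := (tendsto_pow_atTop_nhds_zero_of_lt_one
      (r := (1 - (1 + m) / 2) / ((1 + m) / 2)) (div_nonneg (by linarith) hp0.le)
      ((div_lt_one hp0).2 (by linarith))).comp h2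
    have h4 := (h1.mul (h3.const_add 1)).const_mul (1 / 2)
    rw [add_zero, mul_one] at h4
    refine h4.congr' ?_
    filter_upwards [hjk' t] with N hN
    simp only [b]
    rw [← hq1, binomialMass_one_sub hN hp0.ne', Function.comp_apply]
    ring
  have hmain := tendsto_half_sum_abs_sub (a := fun N => fold (k N) (posSpinsMass β 0 N (k N)))
    (b := fun N => fold (k N) (b N)) (p := (1 + m) / 2)
    (v₁ := (1 - m ^ 2) / 4 * (1 + α * β * (1 - m ^ 2) / (1 - β * (1 - m ^ 2))))
    (v₂ := (1 - m ^ 2) / 4) hk (by positivity) (by positivity)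
    (hgood.mono fun N hN => fold_nonneg (posSpinsMass_nonneg hβ 0 hN.1 hN.2))
    (Eventually.of_forall fun N j hj => fold_eq_zero (posSpinsMass_eq_zero β 0 N hj))
    (hgood.mono fun N hN => by
      rw [sum_fold fun j hj => posSpinsMass_sub hj β N, sum_posSpinsMass hβ 0 hN.1 hN.2])
    (Eventually.of_forall fun N => fold_nonneg (hb0 N))
    (Eventually.of_forall fun N j hj => fold_eq_zero (hbs N j hj))
    (Eventually.of_forall fun N => by rw [sum_fold (hbsymm N), hb1])
    (fun t => by
      rw [tendsto_congr' (latticeDensity_eventuallyEq hk hp0 t _)]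
      exact tendsto_sqrt_mul_fold (hjk t) (halim t))
    (fun t => by
      rw [tendsto_congr' (latticeDensity_eventuallyEq hk hp0 t _)]
      exact tendsto_sqrt_mul_fold (hjk t) (hblim t))
  refine hmain.congr' ?_
  filter_upwards [hgood] with N hN
  simp only [abs_fold_sub]
  rw [sum_fold fun j hj => by rw [posSpinsMass_sub hj, hbsymm N j hj],
    tvDist_eq_half_sum (fun A hA => posSpinsLaw_real hβ 0 hN.1 hN.2 hA)
    (fun A hA => mixedBinomialLaw_two_point_real (k N) p q hA)
    (by rw [sum_posSpinsMass hβ 0 hN.1 hN.2, hp, hq]; exact (hb1 N).symm), hp, hq]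

theorem eq_zero_of_isLittleO {k : ℕ → ℕ} {α : ℝ}
    (hkα : Tendsto (fun N : ℕ => (k N : ℝ) / N) atTop (𝓝 α))
    (hko : (fun N : ℕ => (k N : ℝ)) =o[atTop] (fun N : ℕ => (N : ℝ))) : α = 0 :=
  tendsto_nhds_unique hkα hko.tendsto_div_nhds_zero

end CurieWeiss

end

/-! ### The three regimes -/

theorem theorem1p1 (β h α : ℝ) (hβ : 0 < β) (hα : α ∈ Set.Icc (0 : ℝ) 1)
    (k : ℕ → ℕ) (hkN : ∀ᶠ N in atTop, k N ≤ N)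
    (hk : Tendsto k atTop atTop)
    (hkα : Tendsto (fun N : ℕ => (k N : ℝ) / (N : ℝ)) atTop (𝓝 α)) :
    (h = 0 → β < 1 →
      Tendsto (fun N : ℕ => CurieWeiss.tvDist (CurieWeiss.posSpinsLaw β h N (k N))
          (CurieWeiss.binomialLaw (k N) CurieWeiss.halfProb)) atTop
        (𝓝 (CurieWeiss.gaussD ((1 - β + α * β) / (4 * (1 - β))) (1 / 4))) ∧
      (CurieWeiss.gaussD ((1 - β + α * β) / (4 * (1 - β))) (1 / 4) = 0 ↔ α = 0) ∧
      ((fun N : ℕ => (k N : ℝ)) =o[atTop] (fun N : ℕ => (N : ℝ)) →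
        Tendsto (fun N : ℕ => CurieWeiss.tvDist (CurieWeiss.posSpinsLaw β h N (k N))
          (CurieWeiss.binomialLaw (k N) CurieWeiss.halfProb)) atTop (𝓝 0))) ∧
    (h = 0 → 1 < β →
      Tendsto (fun N : ℕ => CurieWeiss.tvDist (CurieWeiss.posSpinsLaw β h N (k N))
          (CurieWeiss.mixedBinomialLaw (k N)
            ((1 / 2 : ℝ≥0∞) • (Measure.dirac (CurieWeiss.plusProb β 0)
              + Measure.dirac (CurieWeiss.minusProb β 0))))) atTop
        (𝓝 (CurieWeiss.gaussD
          ((1 - CurieWeiss.mag β 0 ^ 2) / 4 * (1 + α * β * (1 - CurieWeiss.mag β 0 ^ 2)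
            / (1 - β * (1 - CurieWeiss.mag β 0 ^ 2))))
          ((1 - CurieWeiss.mag β 0 ^ 2) / 4))) ∧
      (CurieWeiss.gaussD
          ((1 - CurieWeiss.mag β 0 ^ 2) / 4 * (1 + α * β * (1 - CurieWeiss.mag β 0 ^ 2)
            / (1 - β * (1 - CurieWeiss.mag β 0 ^ 2))))
          ((1 - CurieWeiss.mag β 0 ^ 2) / 4) = 0 ↔ α = 0) ∧
      ((fun N : ℕ => (k N : ℝ)) =o[atTop] (fun N : ℕ => (N : ℝ)) →
        Tendsto (fun N : ℕ => CurieWeiss.tvDist (CurieWeiss.posSpinsLaw β h N (k N))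
          (CurieWeiss.mixedBinomialLaw (k N)
            ((1 / 2 : ℝ≥0∞) • (Measure.dirac (CurieWeiss.plusProb β 0)
              + Measure.dirac (CurieWeiss.minusProb β 0))))) atTop (𝓝 0))) ∧
    (h ≠ 0 →
      Tendsto (fun N : ℕ => CurieWeiss.tvDist (CurieWeiss.posSpinsLaw β h N (k N))
          (CurieWeiss.binomialLaw (k N) (CurieWeiss.plusProb β h))) atTop
        (𝓝 (CurieWeiss.gaussD
          ((1 - CurieWeiss.mag β h ^ 2) / 4 * (1 + α * β * (1 - CurieWeiss.mag β h ^ 2)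
            / (1 - β * (1 - CurieWeiss.mag β h ^ 2))))
          ((1 - CurieWeiss.mag β h ^ 2) / 4))) ∧
      (CurieWeiss.gaussD
          ((1 - CurieWeiss.mag β h ^ 2) / 4 * (1 + α * β * (1 - CurieWeiss.mag β h ^ 2)
            / (1 - β * (1 - CurieWeiss.mag β h ^ 2))))
          ((1 - CurieWeiss.mag β h ^ 2) / 4) = 0 ↔ α = 0) ∧
      ((fun N : ℕ => (k N : ℝ)) =o[atTop] (fun N : ℕ => (N : ℝ)) →
        Tendsto (fun N : ℕ => CurieWeiss.tvDist (CurieWeiss.posSpinsLaw β h N (k N))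
          (CurieWeiss.binomialLaw (k N) (CurieWeiss.plusProb β h))) atTop (𝓝 0))) := by
  have hlim0 : ∀ {u : ℕ → ℝ} {D : ℝ}, Tendsto u atTop (𝓝 D) → (D = 0 ↔ α = 0) →
      (fun N : ℕ => (k N : ℝ)) =o[atTop] (fun N : ℕ => (N : ℝ)) → Tendsto u atTop (𝓝 0) := by
    intro u D hu hD hko
    rwa [hD.2 (CurieWeiss.eq_zero_of_isLittleO hkα hko)] at hu
  refine ⟨?_, ?_, ?_⟩
  · rintro rfl hβ1
    -- The high-temperature variance is the general formula at `m = 0`.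
    have hD : (1 - β + α * β) / (4 * (1 - β))
        = (1 - (0 : ℝ) ^ 2) / 4 * (1 + α * β * (1 - (0 : ℝ) ^ 2) / (1 - β * (1 - (0 : ℝ) ^ 2))) := by
      have : 1 - β ≠ 0 := by linarith
      rw [zero_pow two_ne_zero, sub_zero, mul_one, mul_one]
      field_simp
    obtain ⟨h1, h2⟩ := CurieWeiss.tendsto_tvDist_binomialLaw (h := 0) (m := 0)
      (p := CurieWeiss.halfProb) (c := β * (1 - β) / 2) hβ (by simp)
      (by simp [CurieWeiss.halfProb])
      (by have := sub_pos.2 hβ1; positivity)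
      (by simpa using CurieWeiss.hasQuadraticGap_of_lt_one) hα.1 hkN hk hkα
    rw [← hD, show (1 - (0 : ℝ) ^ 2) / 4 = 1 / 4 by norm_num] at h1 h2
    exact ⟨h1, h2, hlim0 h1 h2⟩
  · rintro rfl hβ1
    have hmag := CurieWeiss.mag_spec β 0
    obtain ⟨h1, h2⟩ := CurieWeiss.tendsto_tvDist_mixedBinomialLaw
      (p := CurieWeiss.plusProb β 0) (q := CurieWeiss.minusProb β 0) hβ
      (hmag.pos_of_one_lt hβ1) (by simpa using hmag.eq_tanh) rfl rfl hα.1 hkN hk hkα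
    exact ⟨h1, h2, hlim0 h1 h2⟩
  · intro hh
    have hmag := CurieWeiss.mag_spec β h
    -- The external field `h` and the effective field `β m + h` have the same sign, which makes the
    -- gap constant positive.
    have hpos := hmag.div_pos hh
    have hx₀ : β * CurieWeiss.mag β h + h ≠ 0 := by
      intro h0
      rw [h0, div_zero] at hpos
      exact lt_irrefl _ hpos
    obtain ⟨h1, h2⟩ := CurieWeiss.tendsto_tvDist_binomialLaw
      (p := CurieWeiss.plusProb β h) hβ hmag.eq_tanh rfl
      (by rw [mul_div_mul_comm]; exact mul_pos (by positivity) hpos)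
      (CurieWeiss.hasQuadraticGap_of_ne_zero hx₀ hmag.eq_tanh) hα.1 hkN hk hkα
    exact ⟨h1, h2, hlim0 h1 h2⟩
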